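/- Let $d\in\mathbb N$ and let $\mathscr R$ be the family of all sets $A\subsetneq\mathbb R^d$ that are open, increasing ($\mathbf x\in A$ and $\mathbf y\in[0,\infty)^d$ imply $\mathbf x+\mathbf y\in A$), have convex complement $A^c$, and satisfy $\mathbf 0\notin\overline A$. Consider, on a probability space, the following risk model. * Claim vectors $\mathbf X^{(i)}$, $i\ge 1$, with values in $[0,\infty)^d\setminus\{\mathbf 0\}$ almost surely. * Arrival times $T_i=\theta_1+\dots+\theta_i$ with i.i.d. inter-arrival times $\theta_k\ge 0$, the renewal counting process $N(t)=\#\{i\ge 1: T_i\le t\}$, and the renewal function $\lambda(t)=\mathbf E[N(t)]=\sum_{i\ge1}\mathbf P[T_i\le t]$, assumed finite for all $t\ge 0$. * A real càdlàg process $\{\xi(t)\}_{t\ge0}$ with $\xi(0)=0$ ($e^{\xi(t)}$ is the price process of the investment portfolio). * Premium densities $\mathbf c(t)=(c_1(t),\dots,c_d(t))$ with $0\le c_i(t)\le M_i$ for constants $M_i$. The discounted aggregate claims are $\mathbf D(t)=\sum_{i=1}^{N(t)}\mathbf X^{(i)}e^{-\xi(T_i)}$. For $A\in\mathscr R$ put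 $Y_A^{(i)}=\sup\{u:\mathbf X^{(i)}\in uA\}$ (with $\sup\emptyset=0$). Fix $A\in\mathscr R$ and $T\in(0,\infty)$ and assume: 1. There are constants $C_2\ge C_1\ge 0$ (which may depend on $T$) such that almost surely $-C_1\le\xi(t)\le C_2$ for all $t\in[0,T]$. 2. The $\mathbf X^{(i)}$ have a common distribution $F\in(\mathcal D\cap\mathcal L)_A$. That is, the tail $\overline{F}_A(x)=\mathbf P[Y_A^{(1)}>x]$ is positive for every $x$, $\limsup_{x\to\infty}\overline F_A(bx)/\overline F_A(x)<\infty$ for every $b\in(0,1)$, and $\lim_{x\to\infty}\overline F_A(x-a)/\overline F_A(x)=1$ for every $a>0$. Moreover, the $\mathbf X^{(i)}$ are pairwise tail asymptotically independent on $A$: for all $i\ne j$, $$\lim_{x_i\wedge x_j\to\infty}\mathbf P\big[Y_A^{(i)}>x_i\,\big|\,Y_A^{(j)}>x_j\big]=0.$$ 3. The families $\{\mathbf X^{(i)}\}_{i\ge1}$, $\{N(t)\}_{t\ge0}$, $\{\xi(t)\}_{t\ge0}$ and $\{\mathbf c(t)\}_{t\ge0}$ are mutually independent. Let $\Lambda_T=\{t\in(0,T]:\lambda(t)>0\}$,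 and let $\mathbf X$ be a random vector with distribution $F$ that is independent of $\xi$ (for example $\mathbf X=\mathbf X^{(1)}$). Then, as $x\to\infty$, $$\mathbf P[\mathbf D(t)\in xA]\sim\int_0^t\mathbf P\big[\mathbf X e^{-\xi(s)}\in xA\big]\,\lambda(ds)\quad\text{uniformly for } t\in\Lambda_T,$$ that is, $$\lim_{x\to\infty}\ \sup_{t\in\Lambda_T}\left|\frac{\mathbf P[\mathbf D(t)\in xA]}{\int_0^t\mathbf P[\mathbf Xe^{-\xi(s)}\in xA]\,\lambda(ds)}-1\right|=0 .$$ Here $\int_0^t$ is the Lebesgue-Stieltjes integral over $[0,t]$, including the atom of $\lambda$ at $0$, if any. -/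

import Mathlib

open MeasureTheory ProbabilityTheory Filter Topology
open scoped NNReal ENNReal Pointwise

namespace RuinModel

/-! ### The set family `𝓡` and the variable `Y_A` -/

/-- The family `𝓡`: proper subsets `A` of `ℝ^d` that are open and increasing, have convex
complement, and do not have the origin in their closure. -/
structure IsRareSet {d : ℕ} (A : Set (Fin d → ℝ)) : Prop where
  ne_univ : A ≠ Set.univ
  isOpen : IsOpen A
  increasing : ∀ x ∈ A, ∀ y : Fin d → ℝ, 0 ≤ y → x + y ∈ A
  convex_compl : Convex ℝ Aᶜ
  zero_notMem_closure : (0 : Fin d → ℝ) ∉ closure A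

/-- `Y_A = sup {u : v ∈ u A}` as a function of the vector `v`. For `A ∈ 𝓡` the set is bounded
above; when it is empty the value is `0`. -/
noncomputable def scaleSup {d : ℕ} (A : Set (Fin d → ℝ)) (v : Fin d → ℝ) : ℝ :=
  sSup {u : ℝ | v ∈ u • A}

/-- The univariate distribution `F_A`: the law of `Y_A` when the random vector has law `F`. -/
noncomputable def lawOn {d : ℕ} (F : Measure (Fin d → ℝ)) (A : Set (Fin d → ℝ)) : Measure ℝ :=
  F.map (scaleSup A)

section ScaleSup

variable {d : ℕ} {A : Set (Fin d → ℝ)}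

lemma IsRareSet.zero_notMem (hA : IsRareSet A) : (0 : Fin d → ℝ) ∉ A :=
  fun h => hA.zero_notMem_closure (subset_closure h)

lemma IsRareSet.smul_mem (hA : IsRareSet A) {a : Fin d → ℝ} (ha : a ∈ A) {s : ℝ} (hs : 1 ≤ s) :
    s • a ∈ A := by
  by_contra h
  have h0 : (0 : ℝ) < s := by linarith
  have := hA.convex_compl (x := s • a) h (y := 0) hA.zero_notMem
    (a := s⁻¹) (b := 1 - s⁻¹) (by positivity) (by
      have := inv_le_one_of_one_le₀ hs
      linarith) (by ring)
  rw [smul_zero, add_zero, smul_smul, inv_mul_cancel₀ h0.ne', one_smul] at this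
  exact this ha

lemma IsRareSet.bddAbove (hA : IsRareSet A) (v : Fin d → ℝ) : BddAbove {u : ℝ | v ∈ u • A} := by
  obtain ⟨r, hr, hball⟩ := Metric.isOpen_iff.1 (isClosed_closure (s := A)).isOpen_compl 0
    hA.zero_notMem_closure
  refine ⟨‖v‖ / r, ?_⟩
  rintro u ⟨a, ha, rfl⟩
  have hra : r ≤ ‖a‖ := by
    by_contra! h
    exact hball (by simpa using h) (subset_closure ha)
  rw [le_div_iff₀ hr]
  simp only [norm_smul, Real.norm_eq_abs]
  exact mul_le_mul (le_abs_self u) hra hr.le (abs_nonneg u)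

lemma IsRareSet.scaleSup_nonneg (hA : IsRareSet A) (v : Fin d → ℝ) : 0 ≤ scaleSup A v := by
  by_contra! h
  rcases Set.eq_empty_or_nonempty {u : ℝ | v ∈ u • A} with he | ⟨u, hu⟩
  · simp [scaleSup, he] at h
  · have hle : u ≤ scaleSup A v := le_csSup (hA.bddAbove v) hu
    have hu0 : u < 0 := hle.trans_lt h
    obtain ⟨a, ha, hav⟩ := hu
    have hmem : scaleSup A v / 2 ∈ {u : ℝ | v ∈ u • A} := by
      refine ⟨(u / (scaleSup A v / 2)) • a, hA.smul_mem ha ?_, ?_⟩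
      · rw [le_div_iff_of_neg (by linarith)]; linarith
      · have : scaleSup A v / 2 ≠ 0 := by linarith
        simp only [smul_smul]
        rw [mul_div_cancel₀ _ this]
        exact hav
    have := le_csSup (hA.bddAbove v) hmem
    change scaleSup A v / 2 ≤ scaleSup A v at this
    linarith

lemma IsRareSet.lt_scaleSup_iff (hA : IsRareSet A) {x : ℝ} (hx : 0 < x) (v : Fin d → ℝ) :
    x < scaleSup A v ↔ v ∈ x • A := by
  constructor
  · intro h
    have hne : {u : ℝ | v ∈ u • A}.Nonempty := by
      by_contra! he
      simp [scaleSup, he] at h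
      linarith
    obtain ⟨u, ⟨a, ha, hav⟩, hxu⟩ := exists_lt_of_lt_csSup hne h
    refine ⟨(u / x) • a, hA.smul_mem ha ((one_le_div hx).2 hxu.le), ?_⟩
    simp only [smul_smul]
    rw [mul_div_cancel₀ _ hx.ne']
    exact hav
  · intro h
    have hopen : IsOpen {u : ℝ | 0 < u ∧ u⁻¹ • v ∈ A} := by
      rw [isOpen_iff_mem_nhds]
      rintro u ⟨hu, huA⟩
      have hc : ContinuousAt (fun u : ℝ => u⁻¹ • v) u :=
        (continuousAt_inv₀ hu.ne').smul continuousAt_const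
      exact Filter.inter_mem (lt_mem_nhds hu) (hc (hA.isOpen.mem_nhds huA))
    have hx' : x ∈ {u : ℝ | 0 < u ∧ u⁻¹ • v ∈ A} :=
      ⟨hx, (Set.mem_smul_set_iff_inv_smul_mem₀ hx.ne' A v).1 h⟩
    have hev : ∀ᶠ u in 𝓝[>] x, (0 < u ∧ u⁻¹ • v ∈ A) ∧ x < u :=
      Filter.inter_mem (nhdsWithin_le_nhds (hopen.mem_nhds hx')) self_mem_nhdsWithin
    obtain ⟨u, hxu, hu⟩ := hev.exists
    exact lt_of_lt_of_le hu (le_csSup (hA.bddAbove v)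
      ((Set.mem_smul_set_iff_inv_smul_mem₀ hxu.1.ne' A v).2 hxu.2))

lemma IsRareSet.measurable_scaleSup (hA : IsRareSet A) : Measurable (scaleSup A) := by
  have key : ∀ x : ℝ, 0 < x → MeasurableSet {v | x < scaleSup A v} := by
    intro x hx
    simp only [hA.lt_scaleSup_iff hx, Set.ofPred_mem_eq]
    exact (hA.isOpen.smul₀ hx.ne').measurableSet
  refine measurable_of_Ioi fun x => ?_
  rcases lt_trichotomy x 0 with hx | rfl | hx
  · have : scaleSup A ⁻¹' Set.Ioi x = Set.univ :=
      Set.eq_univ_of_forall fun v => hx.trans_le (hA.scaleSup_nonneg v)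
    rw [this]; exact MeasurableSet.univ
  · have : scaleSup A ⁻¹' Set.Ioi 0 = ⋃ n : ℕ, {v | 1 / ((n : ℝ) + 1) < scaleSup A v} := by
      ext v
      simp only [Set.mem_preimage, Set.mem_Ioi, Set.mem_iUnion, Set.mem_ofPred_eq]
      exact ⟨exists_nat_one_div_lt, fun ⟨n, hn⟩ => lt_trans (by positivity) hn⟩
    rw [this]
    exact MeasurableSet.iUnion fun n => key _ (by positivity)
  · exact key x hx

/-- The tail of `F_A` at `x > 0` is the probability of the set `x A`. -/
lemma IsRareSet.lawOn_Ioi (hA : IsRareSet A) (F : Measure (Fin d → ℝ)) {x : ℝ} (hx : 0 < x) :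
    lawOn F A (Set.Ioi x) = F (x • A) := by
  rw [lawOn, Measure.map_apply hA.measurable_scaleSup measurableSet_Ioi]
  congr 1
  ext v
  exact hA.lt_scaleSup_iff hx v

end ScaleSup

/-! ### Heavy-tailed distribution classes -/

/-- A univariate distribution whose right endpoint is infinite: all its tails are positive. -/
def HasInfiniteRightEndpoint (V : Measure ℝ) : Prop := ∀ x : ℝ, 0 < V (Set.Ioi x)

/-- The class `𝓛` of long-tailed distributions on the line. -/
def IsLongTailed (V : Measure ℝ) : Prop :=
  HasInfiniteRightEndpoint V ∧
    ∀ a : ℝ, 0 < a →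
      Tendsto (fun x : ℝ => V.real (Set.Ioi (x - a)) / V.real (Set.Ioi x)) atTop (𝓝 1)

/-- The class `𝓓` of dominatedly varying distributions on the line. -/
def IsDominatedlyVarying (V : Measure ℝ) : Prop :=
  HasInfiniteRightEndpoint V ∧
    ∀ b : ℝ, 0 < b → b < 1 →
      limsup (fun x : ℝ => V (Set.Ioi (b * x)) / V (Set.Ioi x)) atTop < ∞

/-- `F ∈ (𝓓 ∩ 𝓛)_A`. -/
def MemDLOn {d : ℕ} (A : Set (Fin d → ℝ)) (F : Measure (Fin d → ℝ)) : Prop :=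
  IsDominatedlyVarying (lawOn F A) ∧ IsLongTailed (lawOn F A)

/-! ### Tail asymptotic independence -/

/-- `P[Y > y | Z > z] → 0` as `min y z → ∞`. -/
def TailAsympIndep {Ω : Type*} [MeasurableSpace Ω] (P : Measure Ω) (Y Z : Ω → ℝ) : Prop :=
  Tendsto (fun p : ℝ × ℝ => (P[|{ω | p.2 < Z ω}]).real {ω | p.1 < Y ω})
    (comap (fun p : ℝ × ℝ => min p.1 p.2) atTop) (𝓝 0)

/-- Pairwise tail asymptotic independence on `A` (`TAI_A`) of a sequence of random vectors. -/
def PairwiseTAIOn {Ω : Type*} [MeasurableSpace Ω] (P : Measure Ω) {d : ℕ}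
    (A : Set (Fin d → ℝ)) (X : ℕ → Ω → Fin d → ℝ) : Prop :=
  ∀ i j : ℕ, i ≠ j →
    TailAsympIndep P (fun ω => scaleSup A (X i ω)) (fun ω => scaleSup A (X j ω))

/-! ### The renewal counting process -/

section Renewal

variable {Ω : Type*}

/-- The arrival times `T_0 = 0` and `T_n = θ_0 + ⋯ + θ_{n-1}`. -/
def arrivalTime (θ : ℕ → Ω → ℝ≥0) (n : ℕ) (ω : Ω) : ℝ≥0 := ∑ k ∈ Finset.range n, θ k ω

/-- The counting process `N(t) = #{n ≥ 1 : T_n ≤ t}`. -/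
noncomputable def count (θ : ℕ → Ω → ℝ≥0) (t : ℝ≥0) (ω : Ω) : ℕ∞ :=
  {n : ℕ | 1 ≤ n ∧ arrivalTime θ n ω ≤ t}.encard

variable [MeasurableSpace Ω]

/-- The renewal function `λ(t) = E[N(t)]`. -/
noncomputable def renewalFunction (P : Measure Ω) (θ : ℕ → Ω → ℝ≥0) (t : ℝ≥0) : ℝ≥0∞ :=
  ∫⁻ ω, (count θ t ω : ℝ≥0∞) ∂P

/-- The measure `λ(ds)` on `[0, ∞)`, that is `λ(B) = ∑_{n ≥ 1} P[T_n ∈ B]`. -/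
noncomputable def renewalMeasure (P : Measure Ω) (θ : ℕ → Ω → ℝ≥0) : Measure ℝ≥0 :=
  Measure.sum fun n : ℕ => P.map (arrivalTime θ (n + 1))

lemma measurable_arrivalTime {θ : ℕ → Ω → ℝ≥0} (hθ : ∀ k, Measurable (θ k)) (n : ℕ) :
    Measurable (arrivalTime θ n) := by
  unfold arrivalTime
  exact Finset.measurable_fun_sum _ fun k _ => hθ k

/-- The measure `λ(ds)` has distribution function `λ(t)`. -/
lemma renewalMeasure_Iic (P : Measure Ω) {θ : ℕ → Ω → ℝ≥0} (hθ : ∀ k, Measurable (θ k))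
    (t : ℝ≥0) : renewalMeasure P θ (Set.Iic t) = renewalFunction P θ t := by
  have hcount : ∀ ω, (count θ t ω : ℝ≥0∞) =
      ∑' n : ℕ, (arrivalTime θ (n + 1) ⁻¹' Set.Iic t).indicator (fun _ => (1 : ℝ≥0∞)) ω := by
    intro ω
    have h1 : {n : ℕ | 1 ≤ n ∧ arrivalTime θ n ω ≤ t} =
        Nat.succ '' {n : ℕ | arrivalTime θ (n + 1) ω ≤ t} := by
      ext n
      cases n <;> simp
    rw [count, h1, Nat.succ_injective.encard_image, ← ENNReal.tsum_set_one]
    exact tsum_subtype _ fun _ => (1 : ℝ≥0∞)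
  rw [renewalFunction, renewalMeasure, Measure.sum_apply _ measurableSet_Iic]
  simp_rw [hcount]
  rw [lintegral_tsum fun n => (measurable_const.indicator
    (measurable_arrivalTime hθ _ measurableSet_Iic)).aemeasurable]
  refine tsum_congr fun n => ?_
  rw [lintegral_indicator_const (measurable_arrivalTime hθ _ measurableSet_Iic), one_mul,
    Measure.map_apply (measurable_arrivalTime hθ _) measurableSet_Iic]

end Renewal

/-! ### The risk model -/

/-- A real function on `[0, ∞)` that is right-continuous with finite left limits. -/
def IsCadlag (f : ℝ≥0 → ℝ) : Prop :=
  ∀ t : ℝ≥0, ContinuousWithinAt f (Set.Ici t) t ∧ ∃ l : ℝ, Tendsto f (𝓝[<] t) (𝓝 l)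

/-- The `d`-dimensional renewal risk model with common claim counting process, càdlàg returns
and bounded premium densities. The claim `claim i` arrives at time `T_{i+1}`. -/
structure RiskModel (d : ℕ) {Ω : Type*} [MeasurableSpace Ω] (P : Measure Ω) where
  /-- the claim vectors -/
  claim : ℕ → Ω → Fin d → ℝ
  /-- the times between successive arrivals -/
  interarrival : ℕ → Ω → ℝ≥0
  /-- the process `ξ`; the price process of the investment portfolio is `exp (ξ t)` -/
  logPrice : ℝ≥0 → Ω → ℝ
  /-- the premium densities -/
  premium : ℝ≥0 → Ω → Fin d → ℝ
  measurable_claim : ∀ i, Measurable (claim i)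
  claim_nonneg : ∀ i, ∀ᵐ ω ∂P, 0 ≤ claim i ω
  claim_ne_zero : ∀ i, ∀ᵐ ω ∂P, claim i ω ≠ 0
  measurable_interarrival : ∀ k, Measurable (interarrival k)
  iIndepFun_interarrival : iIndepFun interarrival P
  identDistrib_interarrival : ∀ k, IdentDistrib (interarrival k) (interarrival 0) P P
  renewalFunction_lt_top : ∀ t, renewalFunction P interarrival t < ∞
  measurable_logPrice : ∀ t, Measurable (logPrice t)
  isCadlag_logPrice : ∀ ω, IsCadlag fun t => logPrice t ω
  logPrice_zero : ∀ᵐ ω ∂P, logPrice 0 ω = 0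
  measurable_premium : ∀ t, Measurable (premium t)
  premium_bounded : ∃ M : Fin d → ℝ, ∀ t, ∀ᵐ ω ∂P, 0 ≤ premium t ω ∧ premium t ω ≤ M

namespace RiskModel

variable {d : ℕ} {Ω : Type*} [MeasurableSpace Ω] {P : Measure Ω}

/-- The discounted aggregate claims `D(t) = ∑_{i=1}^{N(t)} exp (-ξ(T_i)) X^{(i)}`. The value of
`N(t)` is finite almost surely. -/
noncomputable def discountedClaims (R : RiskModel d P) (t : ℝ≥0) (ω : Ω) : Fin d → ℝ :=
  ∑ i ∈ Finset.range (count R.interarrival t ω).toNat,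
    Real.exp (-R.logPrice (arrivalTime R.interarrival (i + 1) ω) ω) • R.claim i ω

/-- The measure `λ(ds)` of the model. -/
noncomputable def renewal (R : RiskModel d P) : Measure ℝ≥0 := renewalMeasure P R.interarrival

/-- `Λ_T = (0, T] ∩ {t : λ(t) > 0}`. -/
def horizon (R : RiskModel d P) (T : ℝ≥0) : Set ℝ≥0 :=
  Set.Ioc 0 T ∩ {t | 0 < renewalFunction P R.interarrival t}

/-- The claims, the counting process, the returns and the premiums are mutually independent. -/
def MutuallyIndependent (R : RiskModel d P) : Prop :=
  iIndep (![⨆ i, MeasurableSpace.comap (R.claim i) inferInstance,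
    ⨆ t, MeasurableSpace.comap (count R.interarrival t) inferInstance,
    ⨆ t, MeasurableSpace.comap (R.logPrice t) inferInstance,
    ⨆ t, MeasurableSpace.comap (R.premium t) inferInstance] :
      Fin 4 → MeasurableSpace Ω) P

/-- For some `C₂ ≥ C₁ ≥ 0`, almost surely `-C₁ ≤ ξ(t) ≤ C₂` for all `t ∈ [0, T]`. -/
def BoundedReturnsOn (R : RiskModel d P) (T : ℝ≥0) : Prop :=
  ∃ C₁ C₂ : ℝ, 0 ≤ C₁ ∧ C₁ ≤ C₂ ∧
    (∀ᵐ ω ∂P, ∀ t ≤ T, -C₁ ≤ R.logPrice t ω) ∧ (∀ᵐ ω ∂P, ∀ t ≤ T, R.logPrice t ω ≤ C₂)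

/-- The integral of `P[exp (-ξ(s)) X ∈ x A]` against `λ(ds)` over `[0, t]`, where `X` is a claim
vector, here the first one. -/
noncomputable def singleClaimIntegral (R : RiskModel d P) (A : Set (Fin d → ℝ)) (x : ℝ)
    (t : ℝ≥0) : ℝ :=
  (∫⁻ s in Set.Iic t, P {ω | Real.exp (-R.logPrice s ω) • R.claim 0 ω ∈ x • A} ∂(R.renewal)).toReal

end RiskModel

/-- `f(x; t) ∼ g(x; t)` as `x → ∞`, uniformly for `t ∈ S`: the supremum over `t ∈ S` of
`|f(x; t) / g(x; t) - 1|` tends to `0`. -/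
def UniformAsympEquivOn {τ : Type*} (f g : ℝ → τ → ℝ) (S : Set τ) : Prop :=
  TendstoUniformlyOn (fun x t => f x t / g x t) (fun _ => 1) atTop S

end RuinModel

/-!
# Uniform tail asymptotics of discounted aggregate claims

Convexity of `Aᶜ` and monotonicity of `A` make `Y_A` a monotone sublinear function
(`IsRareSet.scaleSup_add_le`, `IsRareSet.scaleSup_mono`). Hence, for nonnegative claims and positive
weights `w i`, the event `∑ w i • X i ∈ x • A` lies between "some `w i * Y i` exceeds `x`" and
"`∑ w i * Y i` exceeds `x`", where `Y i` is the value of `Y_A` at `X i`. The multivariate problem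
becomes one about real variables with a common tail in `𝓓 ∩ 𝓛`.

For a fixed number of terms and deterministic weights in a compact interval `[a, b]` of positive
numbers, both bounding events have probability `∼ ∑ P[w i * Y i > x]`, uniformly in the weights.
Asymptotic independence controls the intersections in Bonferroni's inequality
(`eventually_sum_tail_le`). A large sum in which no single term exceeds `x - L` contains a term above
`x / n` and another one above `L / n`, and dominated variation makes this negligible, while the
shift by `L` is harmless for a long tail (`eventually_measure_lt_sum_le`).

The claims are independent of the pair (arrivals, returns), so `P[D(t) ∈ x A]` is the expectation of
such a probability with the weights `exp (-ξ(T_i))` frozen (`measure_discountedClaims`), and the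
integral against `λ(ds)` is the expectation of the corresponding sum of tails
(`lintegral_singleClaim`). Up to `m` claims, the asymptotics with deterministic weights apply. For
`N(t) > m`, the tail of the sum is at most a polynomial in `N(t)` times the tail of one term
(`measure_lt_sum_le_pow`). The probability of `n + 1` arrivals up to `t` is at most
`P[θ₁ ≤ t]` times a geometrically decreasing factor (`measure_arrivalTime_le`), and the integral is
itself at least a constant times `P[θ₁ ≤ t]` times the tail of one term. This makes the remainder
negligible uniformly in `t`, even as `t` decreases to the left end of `Λ_T`.
-/

namespace RuinModel

/-! ### Sublinearity of `Y_A` -/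

section Geometry

variable {d : ℕ} {A : Set (Fin d → ℝ)}

lemma IsRareSet.scaleSup_zero (hA : IsRareSet A) : scaleSup A 0 = 0 := by
  refine le_antisymm (le_of_forall_pos_le_add fun ε hε => ?_) (hA.scaleSup_nonneg 0)
  by_contra! h
  rw [zero_add, hA.lt_scaleSup_iff hε] at h
  obtain ⟨a, ha, h0⟩ := h
  have : a = 0 := (smul_eq_zero.1 h0).resolve_left hε.ne'
  exact hA.zero_notMem (this ▸ ha)

lemma IsRareSet.scaleSup_smul (hA : IsRareSet A) {c : ℝ} (hc : 0 < c) (v : Fin d → ℝ) :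
    scaleSup A (c • v) = c * scaleSup A v := by
  have key : ∀ x : ℝ, 0 < x → (x < scaleSup A (c • v) ↔ x < c * scaleSup A v) := by
    intro x hx
    rw [hA.lt_scaleSup_iff hx, mul_comm, ← div_lt_iff₀ hc, hA.lt_scaleSup_iff (div_pos hx hc),
      Set.mem_smul_set_iff_inv_smul_mem₀ hx.ne', Set.mem_smul_set_iff_inv_smul_mem₀
      (div_pos hx hc).ne', smul_smul, inv_div, div_eq_inv_mul]
  refine le_antisymm ?_ ?_
  · by_contra! h
    obtain ⟨x, h1, h2⟩ := exists_between h
    have hx : 0 < x := lt_of_le_of_lt (mul_nonneg hc.le (hA.scaleSup_nonneg v)) h1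
    exact absurd ((key x hx).1 h2) h1.not_gt
  · by_contra! h
    obtain ⟨x, h1, h2⟩ := exists_between h
    have hx : 0 < x := lt_of_le_of_lt (hA.scaleSup_nonneg _) h1
    exact absurd ((key x hx).2 h2) h1.not_gt

/-- `Y_A` is subadditive because `Aᶜ` is convex. -/
lemma IsRareSet.scaleSup_add_le (hA : IsRareSet A) (v w : Fin d → ℝ) :
    scaleSup A (v + w) ≤ scaleSup A v + scaleSup A w := by
  refine le_of_forall_pos_le_add fun ε hε => ?_
  have hv := hA.scaleSup_nonneg v
  have hw := hA.scaleSup_nonneg w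
  set a := scaleSup A v + ε / 2 with ha
  set b := scaleSup A w + ε / 2 with hb
  have ha0 : 0 < a := by positivity
  have hb0 : 0 < b := by positivity
  have h1 : a⁻¹ • v ∈ Aᶜ := fun h => by
    have := (hA.lt_scaleSup_iff ha0 v).2 ((Set.mem_smul_set_iff_inv_smul_mem₀ ha0.ne' A v).2 h)
    linarith
  have h2 : b⁻¹ • w ∈ Aᶜ := fun h => by
    have := (hA.lt_scaleSup_iff hb0 w).2 ((Set.mem_smul_set_iff_inv_smul_mem₀ hb0.ne' A w).2 h)
    linarith
  have h3 := hA.convex_compl h1 h2 (a := a / (a + b)) (b := b / (a + b)) (by positivity)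
    (by positivity) (by field_simp)
  have h4 : (a / (a + b)) • a⁻¹ • v + (b / (a + b)) • b⁻¹ • w = (a + b)⁻¹ • (v + w) := by
    rw [smul_smul, smul_smul, smul_add]
    congr 2 <;> field_simp
  rw [h4] at h3
  by_contra! h
  have h5 : a + b < scaleSup A (v + w) := by linarith
  rw [hA.lt_scaleSup_iff (by positivity), Set.mem_smul_set_iff_inv_smul_mem₀ (by positivity)] at h5
  exact h3 h5

/-- `Y_A` is monotone because `A` is increasing. -/
lemma IsRareSet.scaleSup_mono (hA : IsRareSet A) {v w : Fin d → ℝ} (h : v ≤ w) :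
    scaleSup A v ≤ scaleSup A w := by
  by_contra! hlt
  obtain ⟨x, h1, h2⟩ := exists_between hlt
  have hx : 0 < x := lt_of_le_of_lt (hA.scaleSup_nonneg _) h1
  refine absurd ?_ h1.not_gt
  rw [hA.lt_scaleSup_iff hx, Set.mem_smul_set_iff_inv_smul_mem₀ hx.ne'] at h2 ⊢
  have := hA.increasing _ h2 (x⁻¹ • (w - v)) (smul_nonneg (by positivity) (sub_nonneg.2 h))
  rwa [← smul_add, add_sub_cancel] at this

lemma IsRareSet.scaleSup_sum_smul_le (hA : IsRareSet A) (n : ℕ) {w : ℕ → ℝ}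
    (hw : ∀ i < n, 0 < w i) (v : ℕ → Fin d → ℝ) :
    scaleSup A (∑ i ∈ Finset.range n, w i • v i) ≤
      ∑ i ∈ Finset.range n, w i * scaleSup A (v i) := by
  induction n with
  | zero => simp [hA.scaleSup_zero]
  | succ n ih =>
    rw [Finset.sum_range_succ, Finset.sum_range_succ]
    refine (hA.scaleSup_add_le _ _).trans (add_le_add (ih fun i hi => hw i (by omega)) ?_)
    rw [hA.scaleSup_smul (hw n (by omega))]

lemma IsRareSet.le_scaleSup_sum_smul (hA : IsRareSet A) {n : ℕ} {w : ℕ → ℝ}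
    (hw : ∀ i < n, 0 < w i) {v : ℕ → Fin d → ℝ} (hv : ∀ i, 0 ≤ v i) {i : ℕ} (hi : i < n) :
    w i * scaleSup A (v i) ≤ scaleSup A (∑ i ∈ Finset.range n, w i • v i) := by
  rw [← hA.scaleSup_smul (hw i hi)]
  exact hA.scaleSup_mono (Finset.single_le_sum (f := fun i => w i • v i)
    (fun j hj => smul_nonneg (hw j (Finset.mem_range.1 hj)).le (hv j)) (Finset.mem_range.2 hi))

end Geometry

/-! ### Dominated variation and long tails -/

section Tails

variable {V : Measure ℝ}

/-- Halving the argument multiplies a dominatedly varying tail by at most a constant, uniformly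
over the whole half-line. -/
lemma IsDominatedlyVarying.exists_half [IsProbabilityMeasure V] (hV : IsDominatedlyVarying V) :
    ∃ p : ℕ, ∀ x : ℝ, V (Set.Ioi (x / 2)) ≤ 2 ^ p * V (Set.Ioi x) := by
  have h1 := hV.2 (1 / 2) (by norm_num) (by norm_num)
  obtain ⟨C, hC, hCtop⟩ := exists_between h1
  obtain ⟨x₀, hx₀⟩ := eventually_atTop.1 (eventually_lt_of_limsup_lt hC)
  have hpos := hV.1 x₀
  -- below `x₀` the tail is bounded from below by its value at `x₀`, so one constant serves all `x`
  have hK : max C (V (Set.Ioi x₀))⁻¹ ≠ ∞ :=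
    (max_lt hCtop (ENNReal.inv_lt_top.2 hpos)).ne
  obtain ⟨p, hp⟩ := ENNReal.exists_nat_gt hK
  have hp2 : max C (V (Set.Ioi x₀))⁻¹ ≤ 2 ^ p := by
    refine hp.le.trans ?_
    exact_mod_cast (Nat.lt_two_pow_self (n := p)).le
  refine ⟨p, fun x => ?_⟩
  have hx := hV.1 x
  have hxt : V (Set.Ioi x) ≠ ∞ := measure_ne_top _ _
  rw [← ENNReal.div_le_iff hx.ne' hxt]
  refine le_trans ?_ hp2
  rcases le_total x₀ x with h | h
  · have := (hx₀ x h).le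
    rw [one_div_mul_eq_div] at this
    exact this.trans (le_max_left _ _)
  · refine le_trans ?_ (le_max_right _ _)
    rw [ENNReal.div_eq_inv_mul, ← mul_one (V (Set.Ioi x₀))⁻¹]
    exact mul_le_mul' (ENNReal.inv_le_inv.2 (measure_mono (Set.Ioi_subset_Ioi h))) prob_le_one

/-- Polynomial growth of a dominatedly varying tail under downscaling of the argument. -/
lemma tail_div_le {p : ℕ} (hp : ∀ x : ℝ, V (Set.Ioi (x / 2)) ≤ 2 ^ p * V (Set.Ioi x))
    {n : ℕ} (hn : 1 ≤ n) {x : ℝ} (hx : 0 ≤ x) :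
    V (Set.Ioi (x / n)) ≤ (2 * n : ℝ≥0∞) ^ p * V (Set.Ioi x) := by
  have iter : ∀ k : ℕ, V (Set.Ioi (x / 2 ^ k)) ≤ (2 ^ k : ℝ≥0∞) ^ p * V (Set.Ioi x) := by
    intro k
    induction k with
    | zero => simp
    | succ k ih =>
      rw [pow_succ, ← div_div, pow_succ, mul_pow, mul_comm ((2 ^ k : ℝ≥0∞) ^ p), mul_assoc]
      exact (hp _).trans (mul_le_mul' le_rfl ih)
  have h1 : (n : ℝ) ≤ 2 ^ (Nat.log 2 n + 1) := by
    exact_mod_cast (Nat.lt_pow_succ_log_self one_lt_two n).le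
  have h2 : (2 ^ (Nat.log 2 n + 1) : ℝ≥0∞) ≤ 2 * n := by
    rw [pow_succ, mul_comm]
    gcongr
    exact_mod_cast Nat.pow_log_le_self 2 (by omega)
  have hn0 : (0 : ℝ) < n := by exact_mod_cast hn
  refine (measure_mono (Set.Ioi_subset_Ioi ?_)).trans ((iter (Nat.log 2 n + 1)).trans ?_)
  · exact div_le_div_of_nonneg_left hx hn0 h1
  · gcongr

lemma IsLongTailed.eventually_le [IsProbabilityMeasure V] (hV : IsLongTailed V) {a : ℝ}
    (ha : 0 < a) {ε : ℝ≥0} (hε : 0 < ε) :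
    ∀ᶠ x in atTop, V (Set.Ioi (x - a)) ≤ (1 + ε) * V (Set.Ioi x) := by
  have h := (hV.2 a ha).eventually_le_const (u := 1 + (ε : ℝ)) (by
    have : (0 : ℝ) < ε := hε
    linarith)
  filter_upwards [h] with x hx
  have hpos : 0 < V.real (Set.Ioi x) :=
    ENNReal.toReal_pos (hV.1 x).ne' (measure_ne_top _ _)
  rw [div_le_iff₀ hpos] at hx
  have := ENNReal.ofReal_le_ofReal hx
  rw [ENNReal.ofReal_mul (by positivity), measureReal_def, measureReal_def,
    ENNReal.ofReal_toReal (measure_ne_top _ _), ENNReal.ofReal_toReal (measure_ne_top _ _),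
    ENNReal.ofReal_add zero_le_one ε.coe_nonneg] at this
  simpa using this

end Tails

/-! ### Weighted sums with deterministic weights -/

section Sums

variable {Ω : Type*} [MeasurableSpace Ω] {P : Measure Ω}

/-- Bonferroni's lower bound for a union, the intersections being small relative to the sets. -/
lemma sum_measure_le_of_inter_le {n : ℕ} {B : ℕ → Set Ω} (hB : ∀ i, MeasurableSet (B i))
    {δ : ℝ≥0∞} (hδ : ∀ j < n, ∀ i < j, P (B i ∩ B j) ≤ δ * P (B j)) :
    ∑ i ∈ Finset.range n, P (B i) ≤
      P (⋃ i ∈ Finset.range n, B i) + n * δ * ∑ i ∈ Finset.range n, P (B i) := by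
  suffices h : ∀ m ≤ n, ∑ i ∈ Finset.range m, P (B i) ≤
      P (⋃ i ∈ Finset.range m, B i) + n * δ * ∑ i ∈ Finset.range m, P (B i) from h n le_rfl
  intro m hm
  induction m with
  | zero => simp
  | succ m ih =>
    have h1 : (⋃ i ∈ Finset.range (m + 1), B i) = (⋃ i ∈ Finset.range m, B i) ∪ B m := by
      rw [Finset.range_add_one, Finset.set_biUnion_insert, Set.union_comm]
    have h2 := measure_union_add_inter (μ := P) (⋃ i ∈ Finset.range m, B i) (hB m)
    have h3 : P ((⋃ i ∈ Finset.range m, B i) ∩ B m) ≤ n * δ * P (B m) := by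
      rw [Set.iUnion₂_inter]
      refine (measure_biUnion_finset_le _ _).trans ?_
      refine (Finset.sum_le_sum fun i hi =>
        hδ m (by omega) i (Finset.mem_range.1 hi)).trans ?_
      rw [Finset.sum_const, Finset.card_range, nsmul_eq_mul, mul_assoc]
      gcongr
      omega
    rw [Finset.sum_range_succ, h1, mul_add]
    calc _ ≤ (P (⋃ i ∈ Finset.range m, B i) + n * δ * ∑ i ∈ Finset.range m, P (B i)) + P (B m) := by
          gcongr
          exact ih (by omega)
      _ = (P (⋃ i ∈ Finset.range m, B i) + P (B m)) + n * δ * ∑ i ∈ Finset.range m, P (B i) := by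
          ring
      _ ≤ (P ((⋃ i ∈ Finset.range m, B i) ∪ B m) + n * δ * P (B m))
          + n * δ * ∑ i ∈ Finset.range m, P (B i) := by
          rw [← h2]; gcongr
      _ = _ := by ring

lemma TailAsympIndep.exists_inter_le [IsFiniteMeasure P] {Y Z : Ω → ℝ} (h : TailAsympIndep P Y Z)
    (hZ : Measurable Z) {ε : ℝ≥0} (hε : 0 < ε) :
    ∀ᶠ M in atTop, ∀ y z : ℝ, M ≤ y → M ≤ z →
      P ({ω | y < Y ω} ∩ {ω | z < Z ω}) ≤ ε * P {ω | z < Z ω} := by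
  have h1 := h.eventually_le_const (u := (ε : ℝ)) hε
  rw [eventually_comap] at h1
  obtain ⟨M₀, hM₀⟩ := eventually_atTop.1 h1
  filter_upwards [eventually_ge_atTop M₀] with M hM y z hy hz
  have h2 := hM₀ (min y z) (hM.trans (le_min hy hz)) (y, z) rfl
  have hm : MeasurableSet {ω | z < Z ω} := measurableSet_lt measurable_const hZ
  simp only at h2
  rw [measureReal_def, cond_apply hm, ENNReal.toReal_mul, ENNReal.toReal_inv, ← measureReal_def,
    ← measureReal_def, Set.inter_comm] at h2
  rcases eq_or_ne (P {ω | z < Z ω}) 0 with h0 | h0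
  · rw [h0, mul_zero]
    exact (measure_mono Set.inter_subset_right).trans h0.le
  · have hpos : 0 < P.real {ω | z < Z ω} := ENNReal.toReal_pos h0 (measure_ne_top _ _)
    rw [inv_mul_le_iff₀ hpos, mul_comm] at h2
    have := ENNReal.ofReal_le_ofReal h2
    rw [ENNReal.ofReal_mul ε.coe_nonneg, measureReal_def, measureReal_def,
      ENNReal.ofReal_toReal (measure_ne_top _ _),
      ENNReal.ofReal_toReal (measure_ne_top _ _)] at this
    simpa using this

variable {V : Measure ℝ} {Y : ℕ → Ω → ℝ}

lemma measure_lt_mul {i : ℕ} (hYm : ∀ i, Measurable (Y i)) (hYV : ∀ i, P.map (Y i) = V) {w : ℝ}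
    (hw : 0 < w) (x : ℝ) : P {ω | x < w * Y i ω} = V (Set.Ioi (x / w)) := by
  rw [← hYV i, Measure.map_apply (hYm i) measurableSet_Ioi]
  congr 1
  ext ω
  simp [div_lt_iff₀' hw]

/-- The lower half of the uniform asymptotics: by asymptotic independence, simultaneous large
weighted variables are negligible. -/
lemma eventually_sum_tail_le [IsFiniteMeasure P] (hYm : ∀ i, Measurable (Y i))
    (hYV : ∀ i, P.map (Y i) = V) (hT : ∀ i j, i ≠ j → TailAsympIndep P (Y i) (Y j)) (n : ℕ) {b : ℝ}
    (hb : 0 < b) {ε : ℝ≥0} (hε : 0 < ε) :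
    ∀ᶠ x in atTop, ∀ w : ℕ → ℝ, (∀ i < n, 0 < w i ∧ w i ≤ b) →
      ∑ i ∈ Finset.range n, V (Set.Ioi (x / w i)) ≤
        P (⋃ i ∈ Finset.range n, {ω | x < w i * Y i ω}) +
          ε * ∑ i ∈ Finset.range n, V (Set.Ioi (x / w i)) := by
  set δ : ℝ≥0 := ε / (n + 1) with hδ
  have hδ0 : 0 < δ := by positivity
  have hnδ : (n : ℝ≥0∞) * δ ≤ ε := by
    have : (n : ℝ≥0) * δ ≤ ε := by
      rw [hδ, mul_div_assoc', div_le_iff₀ (by positivity), mul_comm]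
      gcongr
      simp
    exact_mod_cast this
  have hpair : ∀ᶠ M in atTop, ∀ j ∈ Finset.range n, ∀ i ∈ Finset.range j, ∀ y z : ℝ,
      M ≤ y → M ≤ z → P ({ω | y < Y i ω} ∩ {ω | z < Y j ω}) ≤ δ * P {ω | z < Y j ω} := by
    rw [Filter.eventually_all_finset]
    intro j _
    rw [Filter.eventually_all_finset]
    intro i hi
    exact (hT i j (Finset.mem_range.1 hi).ne).exists_inter_le (hYm j) hδ0
  obtain ⟨M, hM⟩ := hpair.exists
  filter_upwards [eventually_ge_atTop 0, eventually_ge_atTop (M * b)] with x hx0 hxM w hw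
  have hMw : ∀ i < n, M ≤ x / w i := fun i hi =>
    ((le_div_iff₀ hb).2 hxM).trans (div_le_div_of_nonneg_left hx0 (hw i hi).1 (hw i hi).2)
  have hset : ∀ i < n, {ω | x < w i * Y i ω} = {ω | x / w i < Y i ω} := by
    intro i hi
    ext ω
    simp [div_lt_iff₀' (hw i hi).1]
  have key := sum_measure_le_of_inter_le (P := P) (n := n) (B := fun i => {ω | x < w i * Y i ω})
    (fun i => measurableSet_lt measurable_const ((hYm i).const_mul _)) (δ := δ) (by
      intro j hj i hij
      simp only [hset i (hij.trans hj), hset j hj]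
      exact hM j (Finset.mem_range.2 hj) i (Finset.mem_range.2 hij) _ _
        (hMw i (hij.trans hj)) (hMw j hj))
  have hs : ∑ i ∈ Finset.range n, P {ω | x < w i * Y i ω} =
      ∑ i ∈ Finset.range n, V (Set.Ioi (x / w i)) :=
    Finset.sum_congr rfl fun i hi => measure_lt_mul hYm hYV (hw i (Finset.mem_range.1 hi)).1 x
  rw [hs] at key
  exact key.trans (by gcongr)

/-- If a sum of `n` numbers exceeds `x`, then one of them exceeds `x - L`, or one exceeds `x / n`
and another one `L / n`. -/
lemma exists_large_of_lt_sum {n : ℕ} {s : ℕ → ℝ} {x L : ℝ} (hL : 0 ≤ L) (hn : 0 < n)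
    (h : x < ∑ i ∈ Finset.range n, s i) :
    ∃ i ∈ Finset.range n, x - L < s i ∨
      ∃ j ∈ (Finset.range n).erase i, L / n < s j ∧ x / n < s i := by
  have hn0 : (0 : ℝ) < n := by exact_mod_cast hn
  obtain ⟨i, hi, hxi⟩ : ∃ i ∈ Finset.range n, x / n < s i := by
    by_contra! hc
    have := Finset.sum_le_sum hc
    rw [Finset.sum_const, Finset.card_range, nsmul_eq_mul, mul_div_cancel₀ _ hn0.ne'] at this
    linarith
  refine ⟨i, hi, ?_⟩
  by_contra! hc
  obtain ⟨h1, h2⟩ := hc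
  have h3 : ∑ j ∈ (Finset.range n).erase i, s j ≤ ∑ j ∈ (Finset.range n).erase i, L / n :=
    Finset.sum_le_sum fun j hj => by
      by_contra! h4
      exact absurd (h2 j hj h4) hxi.not_ge
  rw [Finset.sum_const, Finset.card_erase_of_mem hi, Finset.card_range, nsmul_eq_mul] at h3
  have h4 : ((n - 1 : ℕ) : ℝ) * (L / n) ≤ n * (L / n) := by
    gcongr
    omega
  rw [mul_div_cancel₀ _ hn0.ne'] at h4
  have h5 := Finset.sum_erase_add (Finset.range n) s hi
  linarith

/-- The upper half of the uniform asymptotics: a large weighted sum is caused by a single large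
term, up to a bounded shift, which a long tail does not feel. -/
lemma eventually_measure_lt_sum_le [IsFiniteMeasure P] [IsProbabilityMeasure V]
    (hYm : ∀ i, Measurable (Y i)) (hYV : ∀ i, P.map (Y i) = V) (hV : IsLongTailed V) {p : ℕ}
    (hp : ∀ x : ℝ, V (Set.Ioi (x / 2)) ≤ 2 ^ p * V (Set.Ioi x))
    (hT : ∀ i j, i ≠ j → TailAsympIndep P (Y i) (Y j)) (n : ℕ) {a b : ℝ} (ha : 0 < a)
    {ε : ℝ≥0} (hε : 0 < ε) :
    ∀ᶠ x in atTop, ∀ w : ℕ → ℝ, (∀ i < n, a ≤ w i ∧ w i ≤ b) →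
      P {ω | x < ∑ i ∈ Finset.range n, w i * Y i ω} ≤
        (1 + ε) * ∑ i ∈ Finset.range n, V (Set.Ioi (x / w i)) := by
  rcases Nat.eq_zero_or_pos n with rfl | hn
  · filter_upwards [eventually_ge_atTop 0] with x hx w _
    simp [hx.not_gt]
  rcases lt_or_ge b a with hba | hab
  · exact Eventually.of_forall fun x w hw =>
      absurd (((hw 0 hn).1.trans (hw 0 hn).2).trans_lt hba) (lt_irrefl a)
  have hb : 0 < b := ha.trans_le hab
  have hn0 : (0 : ℝ) < n := by exact_mod_cast hn
  set δ : ℝ≥0 := ε / 2 / (n * (2 * n) ^ p + 1) with hδ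
  have hδ0 : 0 < δ := by positivity
  have hnδ : (n : ℝ≥0∞) * (δ * (2 * n) ^ p) ≤ (ε / 2 : ℝ≥0) := by
    have : (n : ℝ≥0) * (δ * (2 * n) ^ p) ≤ ε / 2 := by
      have h : (n : ℝ≥0) * (δ * (2 * n) ^ p) = ε / 2 * (n * (2 * n) ^ p) /
          (n * (2 * n) ^ p + 1) := by rw [hδ]; ring
      rw [h, div_le_iff₀ (by positivity)]
      gcongr
      simp
    exact_mod_cast this
  have hpair : ∀ᶠ M in atTop, ∀ i ∈ Finset.range n, ∀ j ∈ (Finset.range n).erase i, ∀ y z : ℝ,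
      M ≤ y → M ≤ z → P ({ω | y < Y j ω} ∩ {ω | z < Y i ω}) ≤ δ * P {ω | z < Y i ω} := by
    rw [Filter.eventually_all_finset]
    intro i _
    rw [Filter.eventually_all_finset]
    intro j hj
    exact (hT j i (Finset.ne_of_mem_erase hj)).exists_inter_le (hYm i) hδ0
  obtain ⟨M, hM, hM0⟩ := (hpair.and (eventually_gt_atTop 0)).exists
  -- this shift makes `L / n < w j * Y j` force `M < Y j` for all weights up to `b`
  set L : ℝ := n * b * M with hL
  have hL0 : 0 < L := by positivity
  obtain ⟨u₀, hu₀⟩ := eventually_atTop.1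
    (hV.eventually_le (a := L / a) (by positivity) (ε := ε / 2) (by positivity))
  filter_upwards [eventually_ge_atTop 0, eventually_ge_atTop (M * n * b),
    eventually_ge_atTop (u₀ * b)] with x hx0 hxM hxu w hw
  have hwpos : ∀ i < n, 0 < w i := fun i hi => ha.trans_le (hw i hi).1
  have hxw : ∀ i < n, x / b ≤ x / w i := fun i hi =>
    div_le_div_of_nonneg_left hx0 (hwpos i hi) (hw i hi).2
  have hsub : {ω | x < ∑ i ∈ Finset.range n, w i * Y i ω} ⊆
      ⋃ i ∈ Finset.range n, ({ω | x - L < w i * Y i ω} ∪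
        ⋃ j ∈ (Finset.range n).erase i, ({ω | M < Y j ω} ∩ {ω | x / w i / n < Y i ω})) := by
    intro ω hω
    obtain ⟨i, hi, h⟩ := exists_large_of_lt_sum hL0.le hn hω
    refine Set.mem_biUnion hi ?_
    rcases h with h | ⟨j, hj, h1, h2⟩
    · exact Or.inl h
    · refine Or.inr (Set.mem_biUnion hj ⟨?_, ?_⟩)
      · have hjn := Finset.mem_range.1 (Finset.mem_of_mem_erase hj)
        have h3 : L / n = b * M := by rw [hL]; field_simp
        rw [h3] at h1
        change M < Y j ω
        by_contra! hc
        have h4 : w j * Y j ω ≤ w j * M := mul_le_mul_of_nonneg_left hc (hwpos j hjn).le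
        have h5 : w j * M ≤ b * M := mul_le_mul_of_nonneg_right (hw j hjn).2 hM0.le
        linarith
      · change x / w i / n < Y i ω
        rw [div_right_comm, div_lt_iff₀' (hwpos i (Finset.mem_range.1 hi))]
        exact h2
  refine (measure_mono hsub).trans ((measure_biUnion_finset_le _ _).trans ?_)
  rw [Finset.mul_sum]
  refine Finset.sum_le_sum fun i hi => ?_
  have hin := Finset.mem_range.1 hi
  refine (measure_union_le _ _).trans ?_
  have h1 : P {ω | x - L < w i * Y i ω} ≤ (1 + (ε / 2 : ℝ≥0)) * V (Set.Ioi (x / w i)) := by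
    rw [measure_lt_mul hYm hYV (hwpos i hin)]
    refine le_trans (measure_mono (Set.Ioi_subset_Ioi ?_))
      (hu₀ (x / w i) (((le_div_iff₀ hb).2 hxu).trans (hxw i hin)))
    rw [sub_div]
    exact sub_le_sub_left (div_le_div_of_nonneg_left hL0.le ha (hw i hin).1) _
  have h2 : P (⋃ j ∈ (Finset.range n).erase i, ({ω | M < Y j ω} ∩ {ω | x / w i / n < Y i ω})) ≤
      n * (δ * (2 * n) ^ p) * V (Set.Ioi (x / w i)) := by
    refine (measure_biUnion_finset_le _ _).trans ?_
    have h3 : ∀ j ∈ (Finset.range n).erase i,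
        P ({ω | M < Y j ω} ∩ {ω | x / w i / n < Y i ω}) ≤
          δ * (2 * n) ^ p * V (Set.Ioi (x / w i)) := by
      intro j hj
      refine (hM i hi j hj M (x / w i / n) le_rfl ?_).trans ?_
      · rw [le_div_iff₀ hn0]
        exact ((le_div_iff₀ hb).2 hxM).trans (hxw i hin)
      · have h4 : P {ω | x / w i / n < Y i ω} = V (Set.Ioi (x / w i / n)) := by
          rw [← hYV i, Measure.map_apply (hYm i) measurableSet_Ioi]
          rfl
        rw [h4, mul_assoc]
        gcongr
        exact tail_div_le hp hn (div_nonneg hx0 (hwpos i hin).le)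
    refine (Finset.sum_le_sum h3).trans ?_
    rw [Finset.sum_const, nsmul_eq_mul, ← mul_assoc]
    gcongr
    exact (Finset.card_erase_le).trans (Finset.card_range n).le
  calc _ ≤ (1 + (ε / 2 : ℝ≥0)) * V (Set.Ioi (x / w i)) + (ε / 2 : ℝ≥0) * V (Set.Ioi (x / w i)) :=
        add_le_add h1 (h2.trans (by gcongr))
    _ = (1 + ε) * V (Set.Ioi (x / w i)) := by
        rw [← add_mul, add_assoc, ← ENNReal.coe_add, add_halves]

/-- A bound for the tail of a weighted sum that is polynomial in the number of terms. -/
lemma measure_lt_sum_le_pow (hYm : ∀ i, Measurable (Y i)) (hYV : ∀ i, P.map (Y i) = V) {p : ℕ}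
    (hp : ∀ x : ℝ, V (Set.Ioi (x / 2)) ≤ 2 ^ p * V (Set.Ioi x)) {n : ℕ} {b : ℝ} (hb : 0 < b)
    {x : ℝ} (hx : 0 ≤ x) {w : ℕ → ℝ} (hw : ∀ i < n, 0 < w i ∧ w i ≤ b) :
    P {ω | x < ∑ i ∈ Finset.range n, w i * Y i ω} ≤ n * (2 * n) ^ p * V (Set.Ioi (x / b)) := by
  rcases Nat.eq_zero_or_pos n with rfl | hn
  · simp [hx.not_gt]
  have hn0 : (0 : ℝ) < n := by exact_mod_cast hn
  have hsub : {ω | x < ∑ i ∈ Finset.range n, w i * Y i ω} ⊆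
      ⋃ i ∈ Finset.range n, {ω | x / n < w i * Y i ω} := by
    intro ω hω
    obtain ⟨i, hi, h | ⟨_, _, _, h⟩⟩ := exists_large_of_lt_sum (L := 0) le_rfl hn hω
    · refine Set.mem_biUnion hi (lt_of_le_of_lt ?_ h)
      rw [sub_zero]
      exact div_le_self hx (by exact_mod_cast hn)
    · exact Set.mem_biUnion hi h
  refine (measure_mono hsub).trans ((measure_biUnion_finset_le _ _).trans ?_)
  have h1 : ∀ i ∈ Finset.range n, P {ω | x / n < w i * Y i ω} ≤
      (2 * n) ^ p * V (Set.Ioi (x / b)) := by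
    intro i hi
    have hwi := hw i (Finset.mem_range.1 hi)
    rw [measure_lt_mul hYm hYV hwi.1]
    refine le_trans (measure_mono (Set.Ioi_subset_Ioi ?_)) (tail_div_le hp hn (div_nonneg hx hb.le))
    rw [div_right_comm]
    exact div_le_div_of_nonneg_left (by positivity) hwi.1 hwi.2
  refine (Finset.sum_le_sum h1).trans ?_
  rw [Finset.sum_const, Finset.card_range, nsmul_eq_mul, mul_assoc]

end Sums
/-! ### Moments of the renewal counting process -/

section RenewalBounds

variable {Ω : Type*} {θ : ℕ → Ω → ℝ≥0}

lemma arrivalTime_mono (ω : Ω) : Monotone fun n => arrivalTime θ n ω := fun _ _ h =>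
  Finset.sum_le_sum_of_subset (Finset.range_subset_range.2 h)

lemma le_count_iff {n : ℕ} (hn : 1 ≤ n) (t : ℝ≥0) (ω : Ω) :
    (n : ℕ∞) ≤ count θ t ω ↔ arrivalTime θ n ω ≤ t := by
  constructor
  · intro h
    by_contra hc
    have hsub : {k : ℕ | 1 ≤ k ∧ arrivalTime θ k ω ≤ t} ⊆ (Finset.Icc 1 (n - 1) : Finset ℕ) := by
      rintro k ⟨hk, hkt⟩
      have : k < n := by
        by_contra! hnk
        exact hc ((arrivalTime_mono ω hnk).trans hkt)
      rw [Finset.coe_Icc]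
      exact ⟨hk, by omega⟩
    have h2 := h.trans (Set.encard_le_encard hsub)
    rw [Set.encard_coe_eq_coe_finsetCard, Nat.card_Icc] at h2
    have : n ≤ n - 1 + 1 - 1 := by exact_mod_cast h2
    omega
  · intro h
    have hsub : ((Finset.Icc 1 n : Finset ℕ) : Set ℕ) ⊆
        {k : ℕ | 1 ≤ k ∧ arrivalTime θ k ω ≤ t} := by
      intro k hk
      rw [Finset.coe_Icc] at hk
      exact ⟨hk.1, (arrivalTime_mono ω hk.2).trans h⟩
    have h2 := Set.encard_le_encard hsub
    rw [Set.encard_coe_eq_coe_finsetCard, Nat.card_Icc, Nat.add_sub_cancel] at h2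
    exact h2

lemma lt_toNat_count_iff {t : ℝ≥0} {ω : Ω} (h : count θ t ω ≠ ⊤) (i : ℕ) :
    i < (count θ t ω).toNat ↔ arrivalTime θ (i + 1) ω ≤ t := by
  rw [← le_count_iff (by omega), ← Nat.succ_le_iff, ← Nat.cast_le (α := ℕ∞), ENat.natCast_toNat h]

lemma arrivalTime_toNat_count_le {t : ℝ≥0} {ω : Ω} (h : 0 < (count θ t ω).toNat) :
    arrivalTime θ (count θ t ω).toNat ω ≤ t := by
  have h0 : count θ t ω ≠ ⊤ := fun h1 => by simp [h1] at h
  rw [← le_count_iff h, ENat.natCast_toNat h0]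

lemma arrivalTime_le_of_lt_toNat_count {t : ℝ≥0} {ω : Ω} {i : ℕ}
    (h : i < (count θ t ω).toNat) : arrivalTime θ (i + 1) ω ≤ t :=
  (arrivalTime_mono ω h).trans (arrivalTime_toNat_count_le (by omega))

/-- The arrival times are functions of the counting process. -/
lemma measurable_arrivalTime_of_measurable_count {m : MeasurableSpace Ω}
    (h : ∀ t, Measurable[m] (count θ t)) (n : ℕ) : Measurable[m] (arrivalTime θ (n + 1)) := by
  refine measurable_of_Iic fun t => ?_
  have : arrivalTime θ (n + 1) ⁻¹' Set.Iic t = count θ t ⁻¹' Set.Ici ((n + 1 : ℕ) : ℕ∞) := by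
    ext ω
    exact (le_count_iff (by omega) t ω).symm
  rw [this]
  exact h t (MeasurableSet.of_discrete)

variable [MeasurableSpace Ω]

lemma measurable_count (hθ : ∀ k, Measurable (θ k)) (t : ℝ≥0) : Measurable (count θ t) := by
  have key : ∀ n : ℕ, MeasurableSet {ω | (n : ℕ∞) ≤ count θ t ω} := by
    intro n
    rcases Nat.eq_zero_or_pos n with rfl | hn
    · simp
    · simp only [le_count_iff hn]
      exact measurable_arrivalTime hθ n measurableSet_Iic
  refine ENat.measurable_iff.2 fun n => ?_
  have : count θ t ⁻¹' {(n : ℕ∞)} =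
      {ω | (n : ℕ∞) ≤ count θ t ω} \ {ω | ((n + 1 : ℕ) : ℕ∞) ≤ count θ t ω} := by
    ext ω
    simp only [Set.mem_preimage, Set.mem_singleton_iff, Set.mem_sdiff, Set.mem_ofPred_eq]
    induction count θ t ω using ENat.recTopCoe with
    | top => simp
    | coe k =>
      simp only [Nat.cast_le, Nat.cast_inj]
      omega
  rw [this]
  exact (key n).diff (key (n + 1))

variable {P : Measure Ω}

lemma ae_count_ne_top (hθ : ∀ k, Measurable (θ k)) {t : ℝ≥0} (h : renewalFunction P θ t < ∞) :
    ∀ᵐ ω ∂P, count θ t ω ≠ ⊤ := by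
  have hm : Measurable fun ω => (count θ t ω : ℝ≥0∞) :=
    (Measurable.of_discrete (f := fun n : ℕ∞ => (n : ℝ≥0∞))).comp (measurable_count hθ t)
  filter_upwards [ae_lt_top hm h.ne] with ω hω h0
  simp [h0] at hω

lemma renewalFunction_eq_tsum (hθ : ∀ k, Measurable (θ k)) (t : ℝ≥0) :
    renewalFunction P θ t = ∑' n : ℕ, P {ω | arrivalTime θ (n + 1) ω ≤ t} := by
  rw [← renewalMeasure_Iic P hθ, renewalMeasure, Measure.sum_apply _ measurableSet_Iic]
  exact tsum_congr fun n => Measure.map_apply (measurable_arrivalTime hθ _) measurableSet_Iic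

lemma measure_first_pos (hθ : ∀ k, Measurable (θ k)) {t : ℝ≥0}
    (h : 0 < renewalFunction P θ t) : 0 < P {ω | θ 0 ω ≤ t} := by
  rw [pos_iff_ne_zero] at h ⊢
  contrapose! h
  rw [renewalFunction_eq_tsum hθ]
  refine ENNReal.tsum_eq_zero.2 fun n => measure_mono_null (fun ω hω => ?_) h
  refine le_trans ?_ (show arrivalTime θ (n + 1) ω ≤ t from hω)
  simpa [arrivalTime] using arrivalTime_mono (θ := θ) ω (show 1 ≤ n + 1 by omega)

/-- The Laplace transform of the inter-arrival times, at the argument `1`. -/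
noncomputable def laplaceOne (P : Measure Ω) (θ : ℕ → Ω → ℝ≥0) : ℝ≥0∞ :=
  ∫⁻ ω, ENNReal.ofReal (Real.exp (-(θ 0 ω : ℝ))) ∂P

/-- Finiteness of the renewal function rules out inter-arrival times concentrated at `0`. -/
lemma laplaceOne_lt_one [IsProbabilityMeasure P] (hθ : ∀ k, Measurable (θ k))
    (hid : ∀ k, IdentDistrib (θ k) (θ 0) P P) (h : renewalFunction P θ 0 < ∞) :
    laplaceOne P θ < 1 := by
  have hle : ∀ ω, ENNReal.ofReal (Real.exp (-(θ 0 ω : ℝ))) ≤ 1 := fun ω => by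
    rw [← ENNReal.ofReal_one]
    exact ENNReal.ofReal_le_ofReal (Real.exp_le_one_iff.2 (by simp))
  by_contra! hc
  have hfin : laplaceOne P θ ≠ ∞ := by
    refine ne_top_of_le_ne_top ENNReal.one_ne_top ((lintegral_mono hle).trans ?_)
    simp
  have hae := ae_eq_of_ae_le_of_lintegral_le (Eventually.of_forall hle) hfin aemeasurable_const
    (by simpa [laplaceOne] using hc)
  have h0 : ∀ᵐ ω ∂P, θ 0 ω = 0 := by
    filter_upwards [hae] with ω hω
    rw [ENNReal.ofReal_eq_one, Real.exp_eq_one_iff] at hω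
    simpa using hω
  have hall : ∀ᵐ ω ∂P, ∀ k, θ k ω = 0 := by
    rw [ae_all_iff]
    intro k
    exact (hid k).symm.ae_mem_snd (t := {0}) (measurableSet_singleton 0) h0
  rw [renewalFunction_eq_tsum hθ] at h
  have h1 : ∀ n : ℕ, P {ω | arrivalTime θ (n + 1) ω ≤ 0} = 1 := by
    intro n
    refine (mem_ae_iff_prob_eq_one (s := {ω | arrivalTime θ (n + 1) ω ≤ 0})
      (measurable_arrivalTime hθ _ measurableSet_Iic)).1 ?_
    filter_upwards [hall] with ω hω
    simp [arrivalTime, hω]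
  simp_rw [h1] at h
  exact h.ne (ENNReal.tsum_const_eq_top_of_ne_zero one_ne_zero)

/-- An exponential bound on the number of arrivals that keeps the factor `P[θ₁ ≤ t]`, so that it
is effective uniformly for small `t`. -/
lemma measure_arrivalTime_le (hθ : ∀ k, Measurable (θ k))
    (hind : iIndepFun θ P) (hid : ∀ k, IdentDistrib (θ k) (θ 0) P P) {t T : ℝ≥0} (ht : t ≤ T)
    (n : ℕ) : P {ω | arrivalTime θ (n + 1) ω ≤ t} ≤
      ENNReal.ofReal (Real.exp T) * laplaceOne P θ ^ n * P {ω | θ 0 ω ≤ t} := by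
  have hexp : Measurable fun s : ℝ≥0 => ENNReal.ofReal (Real.exp (-(s : ℝ))) := by fun_prop
  -- the first gap enters through an indicator, the later ones through Markov's inequality
  let φ : ℕ → ℝ≥0 → ℝ≥0∞ := fun k => match k with
    | 0 => (Set.Iic t).indicator 1
    | _ + 1 => fun s => ENNReal.ofReal (Real.exp (-(s : ℝ)))
  have hφ : ∀ k, Measurable (φ k) := fun k => match k with
    | 0 => measurable_one.indicator measurableSet_Iic
    | _ + 1 => hexp
  have hprod := lintegral_prod_eq_prod_lintegral_of_indepFun (Finset.range (n + 1))
    (fun k ω => φ k (θ k ω)) (hind.comp φ hφ) fun k => (hφ k).comp (hθ k)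
  have h0 : ∫⁻ ω, φ 0 (θ 0 ω) ∂P = P {ω | θ 0 ω ≤ t} :=
    lintegral_indicator_one (hθ 0 measurableSet_Iic)
  have hk : ∀ k, ∫⁻ ω, φ (k + 1) (θ (k + 1) ω) ∂P = laplaceOne P θ := fun k =>
    ((hid (k + 1)).comp hexp).lintegral_eq
  rw [Finset.prod_range_succ', h0, Finset.prod_congr rfl fun k _ => hk k, Finset.prod_const,
    Finset.card_range] at hprod
  rw [mul_assoc, ← hprod, ← lintegral_const_mul' _ _ ENNReal.ofReal_ne_top,
    ← lintegral_indicator_one (s := {ω | arrivalTime θ (n + 1) ω ≤ t})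
      (measurable_arrivalTime hθ _ measurableSet_Iic)]
  refine lintegral_mono fun ω => ?_
  by_cases hω : ω ∈ {ω | arrivalTime θ (n + 1) ω ≤ t}
  swap
  · rw [Set.indicator_of_notMem hω]
    exact zero_le
  rw [Set.indicator_of_mem hω]
  have hω' : arrivalTime θ (n + 1) ω ≤ t := hω
  have h1 : θ 0 ω ≤ t := by
    refine le_trans ?_ hω'
    simpa [arrivalTime] using arrivalTime_mono (θ := θ) ω (show 1 ≤ n + 1 by omega)
  rw [Finset.prod_range_succ']
  have h2 : φ 0 (θ 0 ω) = 1 := Set.indicator_of_mem (s := Set.Iic t) h1 _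
  rw [h2, mul_one, ← ENNReal.ofReal_prod_of_nonneg fun _ _ => (Real.exp_pos _).le,
    ← ENNReal.ofReal_mul (Real.exp_pos _).le, ← Real.exp_sum, ← Real.exp_add, Pi.one_apply,
    ENNReal.one_le_ofReal, Real.one_le_exp_iff, Finset.sum_neg_distrib]
  have h3 : (∑ k ∈ Finset.range n, θ (k + 1) ω) ≤ T := by
    refine le_trans ?_ (hω'.trans ht)
    rw [arrivalTime, Finset.sum_range_succ']
    exact le_self_add
  have h4 : ((∑ k ∈ Finset.range n, θ (k + 1) ω : ℝ≥0) : ℝ) ≤ T := by exact_mod_cast h3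
  push_cast at h4
  linarith

/-- The moments of `N(t)` over large values are negligible relative to `P[θ₁ ≤ t]`, uniformly
over bounded `t`. -/
lemma exists_lintegral_count_pow_le [IsProbabilityMeasure P] (hθ : ∀ k, Measurable (θ k))
    (hind : iIndepFun θ P) (hid : ∀ k, IdentDistrib (θ k) (θ 0) P P)
    (h0 : renewalFunction P θ 0 < ∞) (T : ℝ≥0) (q : ℕ) {ε : ℝ≥0∞} (hε : 0 < ε) :
    ∃ m : ℕ, ∀ t ≤ T, ∫⁻ ω, (if m < (count θ t ω).toNat then
      ((count θ t ω).toNat : ℝ≥0∞) ^ q else 0) ∂P ≤ ε * P {ω | θ 0 ω ≤ t} := by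
  have hρ := laplaceOne_lt_one hθ hid h0
  set ρ := laplaceOne P θ
  set u : ℕ → ℝ≥0∞ := fun n => ((n + 1 : ℕ) : ℝ≥0∞) ^ q * (ENNReal.ofReal (Real.exp T) * ρ ^ n)
    with hu
  have hsum : ∑' n, u n ≠ ∞ := by
    have hρr : ‖ρ.toReal‖ < 1 := by
      rw [Real.norm_of_nonneg ENNReal.toReal_nonneg]
      exact (ENNReal.toReal_lt_toReal hρ.ne_top ENNReal.one_ne_top).2 hρ |>.trans_eq (by simp)
    have hs : Summable fun n : ℕ => (((n + 1 : ℕ) : ℝ) ^ q * ρ.toReal ^ n) := by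
      refine Summable.of_nonneg_of_le (fun n => by positivity) (fun n => ?_)
        (((summable_pow_mul_geometric_of_norm_lt_one q hρr).mul_left (2 ^ q)).add
          (summable_geometric_of_norm_lt_one hρr))
      rcases Nat.eq_zero_or_pos n with rfl | hn
      · simp
      · have h1 : ((n + 1 : ℕ) : ℝ) ^ q ≤ 2 ^ q * (n : ℝ) ^ q := by
          rw [← mul_pow]
          gcongr
          have : (1 : ℝ) ≤ n := by exact_mod_cast hn
          push_cast
          linarith
        have h2 : 0 ≤ ρ.toReal ^ n := by positivity
        nlinarith [mul_le_mul_of_nonneg_right h1 h2]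
    have h3 : ∀ n, u n = ENNReal.ofReal (Real.exp T) *
        ENNReal.ofReal (((n + 1 : ℕ) : ℝ) ^ q * ρ.toReal ^ n) := by
      intro n
      rw [hu, ENNReal.ofReal_mul (by positivity), ENNReal.ofReal_pow (by positivity),
        ENNReal.ofReal_pow (by positivity), ENNReal.ofReal_natCast, ENNReal.ofReal_toReal hρ.ne_top]
      ring
    simp_rw [h3]
    rw [ENNReal.tsum_mul_left]
    exact ENNReal.mul_ne_top ENNReal.ofReal_ne_top hs.tsum_ofReal_ne_top
  obtain ⟨m, hm⟩ := ((ENNReal.tendsto_sum_nat_add u hsum).eventually_le_const hε).exists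
  refine ⟨m, fun t ht => ?_⟩
  have hpt : ∀ ω, (if m < (count θ t ω).toNat then ((count θ t ω).toNat : ℝ≥0∞) ^ q else 0) ≤
      ∑' k : ℕ, ((k + m + 1 : ℕ) : ℝ≥0∞) ^ q *
        {ω | arrivalTime θ (k + m + 1) ω ≤ t}.indicator 1 ω := by
    intro ω
    split_ifs with h
    · obtain ⟨k, hk⟩ := Nat.exists_eq_add_of_lt h
      have hk' : k + m + 1 = (count θ t ω).toNat := by omega
      refine le_trans ?_ (ENNReal.le_tsum k)
      have hmem : ω ∈ {ω' | arrivalTime θ (count θ t ω).toNat ω' ≤ t} :=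
        arrivalTime_toNat_count_le (by omega)
      rw [hk', Set.indicator_of_mem hmem, Pi.one_apply, mul_one]
    · exact zero_le
  refine (lintegral_mono hpt).trans ?_
  have hms : ∀ k : ℕ, MeasurableSet {ω | arrivalTime θ (k + m + 1) ω ≤ t} := fun k =>
    measurable_arrivalTime hθ _ measurableSet_Iic
  rw [lintegral_tsum fun k => ((measurable_one.indicator (hms k)).const_mul _).aemeasurable]
  refine le_trans (ENNReal.tsum_le_tsum fun k => ?_)
    ((ENNReal.tsum_mul_right).le.trans (mul_le_mul' hm le_rfl))
  rw [lintegral_const_mul _ (measurable_one.indicator (hms k)), lintegral_indicator_one (hms k),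
    hu, mul_assoc]
  gcongr
  exact measure_arrivalTime_le hθ hind hid ht (k + m)

end RenewalBounds
/-! ### Joint measurability and integration over independent components -/

section Independence

variable {Ω : Type*}

/-- A process with right-continuous paths is jointly measurable in time and chance: it is the limit
of its values at the grid points `(⌊n s⌋ + 1) / n`. -/
lemma measurable_uncurry_of_rightContinuous {m : MeasurableSpace Ω} {X : ℝ≥0 → Ω → ℝ}
    (hX : ∀ t, Measurable (X t))
    (hc : ∀ ω t, ContinuousWithinAt (fun s => X s ω) (Set.Ici t) t) :
    Measurable fun q : ℝ≥0 × Ω => X q.1 q.2 := by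
  have hcount : ∀ g : ℕ → ℝ≥0, Measurable fun q : ℕ × Ω => X (g q.1) q.2 := fun g =>
    measurable_from_prod_countable_right fun k => hX (g k)
  have hgrid : ∀ n : ℕ, Measurable fun q : ℝ≥0 × Ω =>
      X ((⌊((n + 1 : ℕ) : ℝ≥0) * q.1⌋₊ + 1 : ℕ) / ((n + 1 : ℕ) : ℝ≥0)) q.2 := by
    intro n
    have h2 : Measurable fun q : ℝ≥0 × Ω => ⌊((n + 1 : ℕ) : ℝ≥0) * q.1⌋₊ :=
      Nat.measurable_floor.comp (measurable_fst.const_mul _)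
    exact (hcount fun k => ((k + 1 : ℕ) : ℝ≥0) / ((n + 1 : ℕ) : ℝ≥0)).comp
      (h2.prodMk measurable_snd)
  refine measurable_of_tendsto_metrizable hgrid ?_
  rw [tendsto_pi_nhds]
  rintro ⟨s, ω⟩
  have hpos : ∀ n : ℕ, (0 : ℝ≥0) < ((n + 1 : ℕ) : ℝ≥0) := fun n => by positivity
  have hge : ∀ n : ℕ, s ≤ (⌊((n + 1 : ℕ) : ℝ≥0) * s⌋₊ + 1 : ℕ) / ((n + 1 : ℕ) : ℝ≥0) := fun n => by
    rw [le_div_iff₀ (hpos n), mul_comm]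
    push_cast
    exact_mod_cast (Nat.lt_floor_add_one _).le
  have hle : ∀ n : ℕ, ((⌊((n + 1 : ℕ) : ℝ≥0) * s⌋₊ + 1 : ℕ) : ℝ≥0) / ((n + 1 : ℕ) : ℝ≥0) ≤
      s + 1 / ((n : ℝ≥0) + 1) := fun n => by
    rw [div_le_iff₀ (hpos n), add_mul]
    push_cast
    rw [one_div, inv_mul_cancel₀ (by positivity), mul_comm s]
    gcongr
    have := Nat.floor_le (zero_le (a := ((n + 1 : ℕ) : ℝ≥0) * s))
    push_cast at this
    exact this
  have hlim : Tendsto (fun n : ℕ => ((⌊((n + 1 : ℕ) : ℝ≥0) * s⌋₊ + 1 : ℕ) : ℝ≥0) /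
      ((n + 1 : ℕ) : ℝ≥0)) atTop (𝓝[Set.Ici s] s) := by
    refine tendsto_nhdsWithin_iff.2 ⟨?_, Eventually.of_forall hge⟩
    refine tendsto_of_tendsto_of_tendsto_of_le_of_le tendsto_const_nhds ?_ hge hle
    simpa using (tendsto_const_nhds (x := s)).add tendsto_one_div_add_atTop_nhds_zero_nat
  exact Tendsto.comp (g := fun r => X r ω) (hc ω s).tendsto hlim

variable {m₀ : MeasurableSpace Ω} {P : Measure Ω}

lemma lintegral_prodMk_of_indepFun {α β : Type*} [MeasurableSpace α] [MeasurableSpace β]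
    [IsFiniteMeasure P] {X : Ω → α} {Z : Ω → β} (hX : Measurable X) (hZ : Measurable Z)
    (h : IndepFun X Z P) {f : α × β → ℝ≥0∞} (hf : Measurable f) :
    ∫⁻ ω, f (X ω, Z ω) ∂P = ∫⁻ a, ∫⁻ ω, f (a, Z ω) ∂P ∂(P.map X) := by
  have h1 := (indepFun_iff_map_prod_eq_prod_map_map hX.aemeasurable hZ.aemeasurable).1 h
  rw [← lintegral_map hf (hX.prodMk hZ), h1, lintegral_prod _ hf.aemeasurable]
  exact lintegral_congr fun a => lintegral_map (hf.comp (measurable_const.prodMk measurable_id)) hZ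

lemma measure_prodMk_of_indepFun {α β : Type*} [MeasurableSpace α] [MeasurableSpace β]
    [IsFiniteMeasure P] {X : Ω → α} {Z : Ω → β} (hX : Measurable X) (hZ : Measurable Z)
    (h : IndepFun X Z P) {S : Set (α × β)} (hS : MeasurableSet S) :
    P {ω | (X ω, Z ω) ∈ S} = ∫⁻ ω, P {ω' | (X ω', Z ω) ∈ S} ∂P := by
  have h1 := (indepFun_iff_map_prod_eq_prod_map_map hX.aemeasurable hZ.aemeasurable).1 h
  have h2 : P {ω | (X ω, Z ω) ∈ S} = P.map (fun ω => (X ω, Z ω)) S :=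
    (Measure.map_apply (hX.prodMk hZ) hS).symm
  rw [h2, h1, Measure.prod_apply_symm hS, lintegral_map (measurable_measure_prodMk_right hS) hZ]
  exact lintegral_congr fun ω =>
    Measure.map_apply hX (measurable_id.prodMk measurable_const hS)

/-- Fubini's theorem for a variable `X` and a σ-algebra `m₂` independent of it: `X` may be frozen
while integrating over the randomness from `m₂`. -/
lemma lintegral_freeze {Ω : Type*} {m₁ m₂ m₀ : MeasurableSpace Ω} {P : Measure Ω}
    {α : Type*} [mα : MeasurableSpace α] [IsFiniteMeasure P] (h₁ : m₁ ≤ m₀) (h₂ : m₂ ≤ m₀)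
    (h : Indep m₁ m₂ P) {X : Ω → α} (hX : Measurable[m₁] X) {f : α × Ω → ℝ≥0∞}
    (hf : Measurable[mα.prod m₂] f) :
    ∫⁻ ω, f (X ω, ω) ∂P = ∫⁻ a, ∫⁻ ω, f (a, ω) ∂P ∂(P.map X) := by
  refine @lintegral_prodMk_of_indepFun Ω m₀ P α Ω mα m₂ _ X id (hX.mono h₁ le_rfl)
    (measurable_id'' h₂) ?_ f hf
  refine (@IndepFun_iff_Indep Ω α Ω m₀ mα m₂ X id P).2 ?_
  rw [MeasurableSpace.comap_id]
  exact indep_of_indep_of_le_left h hX.comap_le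

end Independence
/-! ### Conditioning the risk model on arrivals and returns -/

namespace RiskModel

variable {d : ℕ} {Ω : Type*} [m₀ : MeasurableSpace Ω] {P : Measure Ω} (R : RiskModel d P)

/-- The discount factor `exp (-ξ(T_{i+1}))` of the claim with index `i`. -/
noncomputable def weight (i : ℕ) (ω : Ω) : ℝ :=
  Real.exp (-R.logPrice (arrivalTime R.interarrival (i + 1) ω) ω)

/-- The number `N(t)` of claims up to time `t` as a natural number; infinite values, which have
probability zero, become `0`. -/
noncomputable def number (t : ℝ≥0) (ω : Ω) : ℕ := (count R.interarrival t ω).toNat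

/-- The σ-algebra generated by the claims. -/
@[reducible] noncomputable def claimSigma : MeasurableSpace Ω :=
  ⨆ i, MeasurableSpace.comap (R.claim i) inferInstance

/-- The σ-algebra generated by the counting process. -/
@[reducible] noncomputable def countSigma : MeasurableSpace Ω :=
  ⨆ t, MeasurableSpace.comap (count R.interarrival t) inferInstance

/-- The σ-algebra generated by the log-price process. -/
@[reducible] noncomputable def priceSigma : MeasurableSpace Ω :=
  ⨆ t, MeasurableSpace.comap (R.logPrice t) inferInstance

lemma claimSigma_le : R.claimSigma ≤ m₀ := iSup_le fun i => (R.measurable_claim i).comap_le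

lemma countSigma_le : R.countSigma ≤ m₀ :=
  iSup_le fun t => (measurable_count R.measurable_interarrival t).comap_le

lemma priceSigma_le : R.priceSigma ≤ m₀ := iSup_le fun t => (R.measurable_logPrice t).comap_le

variable {R}

lemma MutuallyIndependent.indep_iSup (h : R.MutuallyIndependent) {S S' : Set (Fin 4)}
    (hS : Disjoint S S') :
    Indep (⨆ i ∈ S, (![R.claimSigma, R.countSigma, R.priceSigma,
      ⨆ t, MeasurableSpace.comap (R.premium t) inferInstance] : Fin 4 → MeasurableSpace Ω) i)
      (⨆ i ∈ S', (![R.claimSigma, R.countSigma, R.priceSigma,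
      ⨆ t, MeasurableSpace.comap (R.premium t) inferInstance] : Fin 4 → MeasurableSpace Ω) i) P := by
  refine indep_iSup_of_disjoint (fun i => ?_) h hS
  fin_cases i
  · exact R.claimSigma_le
  · exact R.countSigma_le
  · exact R.priceSigma_le
  · exact iSup_le fun t => (R.measurable_premium t).comap_le

lemma MutuallyIndependent.indep_claim (h : R.MutuallyIndependent) :
    Indep R.claimSigma (R.countSigma ⊔ R.priceSigma) P := by
  have := h.indep_iSup (S := {0}) (S' := {1, 2}) (by simp)
  simpa [iSup_or, iSup_sup_eq] using this

lemma MutuallyIndependent.indep_count_price (h : R.MutuallyIndependent) :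
    Indep R.countSigma R.priceSigma P := by
  have := h.indep_iSup (S := {1}) (S' := {2}) (by simp)
  simpa using this

variable (R)

lemma measurable_claim_claimSigma (i : ℕ) : Measurable[R.claimSigma] (R.claim i) :=
  Measurable.of_comap_le (le_iSup (fun i => MeasurableSpace.comap (R.claim i) inferInstance) i)

lemma measurable_count_countSigma (t : ℝ≥0) :
    Measurable[R.countSigma] (count R.interarrival t) :=
  Measurable.of_comap_le
    (le_iSup (fun t => MeasurableSpace.comap (count R.interarrival t) inferInstance) t)

lemma measurable_logPrice_priceSigma (t : ℝ≥0) : Measurable[R.priceSigma] (R.logPrice t) :=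
  Measurable.of_comap_le (le_iSup (fun t => MeasurableSpace.comap (R.logPrice t) inferInstance) t)

lemma measurable_uncurry_logPrice :
    Measurable[MeasurableSpace.prod inferInstance R.priceSigma]
      fun q : ℝ≥0 × Ω => R.logPrice q.1 q.2 :=
  measurable_uncurry_of_rightContinuous (m := R.priceSigma) R.measurable_logPrice_priceSigma
    fun ω t => (R.isCadlag_logPrice ω t).1

lemma measurable_arrivalTime_countSigma (i : ℕ) :
    Measurable[R.countSigma] (arrivalTime R.interarrival (i + 1)) :=
  measurable_arrivalTime_of_measurable_count R.measurable_count_countSigma i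

lemma measurable_number_countSigma (t : ℝ≥0) : Measurable[R.countSigma] (R.number t) :=
  (Measurable.of_discrete (f := ENat.toNat)).comp (R.measurable_count_countSigma t)

lemma measurable_weight_sup (i : ℕ) :
    Measurable[R.countSigma ⊔ R.priceSigma] (R.weight i) := by
  have h1 : Measurable[R.countSigma ⊔ R.priceSigma, MeasurableSpace.prod inferInstance R.priceSigma]
      fun ω => (arrivalTime R.interarrival (i + 1) ω, ω) :=
    @Measurable.prodMk Ω (R.countSigma ⊔ R.priceSigma) ℝ≥0 Ω _ R.priceSigma _ _
      ((R.measurable_arrivalTime_countSigma i).mono le_sup_left le_rfl)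
      (measurable_id'' le_sup_right)
  exact Real.measurable_exp.comp (R.measurable_uncurry_logPrice.comp h1).neg

lemma measurable_number (t : ℝ≥0) : Measurable (R.number t) :=
  (R.measurable_number_countSigma t).mono R.countSigma_le le_rfl

lemma measurable_weight (i : ℕ) : Measurable (R.weight i) :=
  (R.measurable_weight_sup i).mono (sup_le R.countSigma_le R.priceSigma_le) le_rfl

lemma weight_pos (i : ℕ) (ω : Ω) : 0 < R.weight i ω := Real.exp_pos _

lemma ae_lt_number_iff (t : ℝ≥0) :
    ∀ᵐ ω ∂P, ∀ i, i < R.number t ω ↔ arrivalTime R.interarrival (i + 1) ω ≤ t := by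
  filter_upwards [ae_count_ne_top R.measurable_interarrival (R.renewalFunction_lt_top t)]
    with ω hω i
  exact lt_toNat_count_iff hω i

variable {R}

/-- The claims are independent of the number of arrivals together with the discount factors. -/
lemma MutuallyIndependent.indepFun_claim_weight (h : R.MutuallyIndependent) (t : ℝ≥0) :
    IndepFun (fun ω i => R.claim i ω) (fun ω => (R.number t ω, fun i => R.weight i ω)) P := by
  rw [IndepFun_iff_Indep]
  refine indep_of_indep_of_le_left (indep_of_indep_of_le_right h.indep_claim ?_) ?_
  · refine Measurable.comap_le ?_
    exact ((R.measurable_number_countSigma t).mono le_sup_left le_rfl).prodMk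
      (@measurable_pi_lambda _ _ _ (R.countSigma ⊔ R.priceSigma) _ _ R.measurable_weight_sup)
  · refine Measurable.comap_le ?_
    exact @measurable_pi_lambda _ _ _ R.claimSigma _ _ R.measurable_claim_claimSigma

/-- Conditionally on arrivals and returns, `D(t)` is a sum with deterministic weights. -/
lemma measure_discountedClaims [IsProbabilityMeasure P] (h : R.MutuallyIndependent)
    {A : Set (Fin d → ℝ)} (hA : IsRareSet A) {x : ℝ} (hx : 0 < x) (t : ℝ≥0) :
    P {ω | R.discountedClaims t ω ∈ x • A} =
      ∫⁻ ω, P {ω' | ∑ i ∈ Finset.range (R.number t ω), R.weight i ω • R.claim i ω' ∈ x • A} ∂P := by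
  have hmeas : Measurable fun q : (ℕ → Fin d → ℝ) × (ℕ × (ℕ → ℝ)) =>
      ∑ i ∈ Finset.range q.2.1, q.2.2 i • q.1 i := by
    have h1 : Measurable fun q : ℕ × ((ℕ → Fin d → ℝ) × (ℕ → ℝ)) =>
        ∑ i ∈ Finset.range q.1, q.2.2 i • q.2.1 i := by
      refine measurable_from_prod_countable_right fun n => ?_
      change Measurable fun y : (ℕ → Fin d → ℝ) × (ℕ → ℝ) =>
        ∑ i ∈ Finset.range n, y.2 i • y.1 i
      fun_prop
    exact h1.comp (measurable_snd.fst.prodMk (measurable_fst.prodMk measurable_snd.snd))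
  exact measure_prodMk_of_indepFun (measurable_pi_lambda _ R.measurable_claim)
    ((R.measurable_number t).prodMk (measurable_pi_lambda _ R.measurable_weight))
    (h.indepFun_claim_weight t) (hmeas (hA.isOpen.smul₀ hx.ne').measurableSet)

lemma measurable_measure_Ioi (V : Measure ℝ) : Measurable fun u : ℝ => V (Set.Ioi u) :=
  Antitone.measurable fun _ _ h => measure_mono (Set.Ioi_subset_Ioi h)

/-- The conditional expectation of the number of discounted claims in `x A` up to time `t`, given
arrivals and returns. -/
noncomputable def conditionalMean (R : RiskModel d P) (V : Measure ℝ) (x : ℝ) (t : ℝ≥0) (ω : Ω) :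
    ℝ≥0∞ := ∑ i ∈ Finset.range (R.number t ω), V (Set.Ioi (x / R.weight i ω))

lemma measurable_conditionalMean (R : RiskModel d P) (V : Measure ℝ) (x : ℝ) (t : ℝ≥0) :
    Measurable (R.conditionalMean V x t) := by
  have h1 : Measurable fun q : ℕ × (ℕ → ℝ) =>
      ∑ i ∈ Finset.range q.1, V (Set.Ioi (x / q.2 i)) := by
    refine measurable_from_prod_countable_right fun n => ?_
    change Measurable fun y : ℕ → ℝ => ∑ i ∈ Finset.range n, V (Set.Ioi (x / y i))
    refine Finset.measurable_fun_sum _ fun i _ => (measurable_measure_Ioi V).comp ?_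
    fun_prop
  exact h1.comp ((R.measurable_number t).prodMk (measurable_pi_lambda _ R.measurable_weight))

lemma measure_exp_smul_claim_mem [IsProbabilityMeasure P] (h : R.MutuallyIndependent)
    {A : Set (Fin d → ℝ)} (hA : IsRareSet A) {x : ℝ} (hx : 0 < x) (s : ℝ≥0) :
    P {ω | Real.exp (-R.logPrice s ω) • R.claim 0 ω ∈ x • A} =
      ∫⁻ ω, lawOn (P.map (R.claim 0)) A (Set.Ioi (x / Real.exp (-R.logPrice s ω))) ∂P := by
  have hind : IndepFun (R.claim 0) (R.logPrice s) P := by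
    rw [IndepFun_iff_Indep]
    exact indep_of_indep_of_le_left (indep_of_indep_of_le_right h.indep_claim
      ((R.measurable_logPrice_priceSigma s).comap_le.trans le_sup_right))
      (R.measurable_claim_claimSigma 0).comap_le
  have hmeas : Measurable fun q : (Fin d → ℝ) × ℝ => Real.exp (-q.2) • q.1 := by fun_prop
  refine (measure_prodMk_of_indepFun (R.measurable_claim 0) (R.measurable_logPrice s) hind
    (hmeas (hA.isOpen.smul₀ hx.ne').measurableSet)).trans (lintegral_congr fun ω => ?_)
  rw [hA.lawOn_Ioi _ (by positivity), Measure.map_apply (R.measurable_claim 0)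
    (hA.isOpen.smul₀ (by positivity)).measurableSet]
  congr 1
  ext ω'
  have hpos := Real.exp_pos (-R.logPrice s ω)
  simp only [Set.mem_preimage, Set.mem_ofPred_eq]
  rw [← hA.lt_scaleSup_iff hx, ← hA.lt_scaleSup_iff (by positivity), hA.scaleSup_smul hpos,
    div_lt_iff₀' hpos]

/-- The integral in the asymptotic formula is the expectation of the conditional mean. -/
lemma lintegral_singleClaim [IsProbabilityMeasure P] (h : R.MutuallyIndependent)
    {A : Set (Fin d → ℝ)} (hA : IsRareSet A) {x : ℝ} (hx : 0 < x) (t : ℝ≥0) :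
    ∫⁻ s in Set.Iic t, P {ω | Real.exp (-R.logPrice s ω) • R.claim 0 ω ∈ x • A} ∂(R.renewal) =
      ∫⁻ ω, R.conditionalMean (lawOn (P.map (R.claim 0)) A) x t ω ∂P := by
  set V := lawOn (P.map (R.claim 0)) A with hV
  let φ : ℝ≥0 × ℝ → ℝ≥0∞ := fun q =>
    (Set.Iic t).indicator (fun _ => V (Set.Ioi (x / Real.exp (-q.2)))) q.1
  have hφ : Measurable φ := by
    have : Measurable fun q : ℝ≥0 × ℝ => V (Set.Ioi (x / Real.exp (-q.2))) :=
      (measurable_measure_Ioi V).comp (by fun_prop)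
    exact this.indicator (measurable_fst measurableSet_Iic)
  have hjoint : Measurable[MeasurableSpace.prod inferInstance R.priceSigma]
      fun q : ℝ≥0 × Ω => φ (q.1, R.logPrice q.1 q.2) :=
    hφ.comp (@Measurable.prodMk (ℝ≥0 × Ω)
      (MeasurableSpace.prod inferInstance R.priceSigma) ℝ≥0 ℝ _ _ _ _
      (@measurable_fst _ _ _ R.priceSigma) R.measurable_uncurry_logPrice)
  have hterm : ∀ i : ℕ, ∫⁻ s in Set.Iic t,
      P {ω | Real.exp (-R.logPrice s ω) • R.claim 0 ω ∈ x • A}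
        ∂(P.map (arrivalTime R.interarrival (i + 1))) =
      ∫⁻ ω, (Set.Iic t).indicator (fun _ => V (Set.Ioi (x / R.weight i ω)))
        (arrivalTime R.interarrival (i + 1) ω) ∂P := by
    intro i
    rw [← lintegral_indicator measurableSet_Iic]
    refine Eq.trans (lintegral_congr fun s => ?_) (lintegral_freeze R.countSigma_le R.priceSigma_le
      h.indep_count_price (R.measurable_arrivalTime_countSigma i) hjoint).symm
    by_cases hs : s ∈ Set.Iic t
    · simp only [φ, Set.indicator_of_mem hs]
      exact measure_exp_smul_claim_mem h hA hx s
    · simp only [φ, Set.indicator_of_notMem hs, lintegral_zero]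
  have hm : ∀ i : ℕ, Measurable fun ω => (Set.Iic t).indicator
      (fun _ => V (Set.Ioi (x / R.weight i ω))) (arrivalTime R.interarrival (i + 1) ω) := fun i =>
    ((measurable_measure_Ioi V).comp ((R.measurable_weight i).const_div x)).indicator
      (measurable_arrivalTime R.measurable_interarrival (i + 1) measurableSet_Iic)
  rw [renewal, renewalMeasure, Measure.restrict_sum _ measurableSet_Iic, lintegral_sum_measure,
    tsum_congr hterm, ← lintegral_tsum fun i => (hm i).aemeasurable]
  refine lintegral_congr_ae ?_
  filter_upwards [R.ae_lt_number_iff t] with ω hω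
  rw [conditionalMean, tsum_eq_sum (s := Finset.range (R.number t ω))]
  · refine Finset.sum_congr rfl fun i hi => Set.indicator_of_mem (s := Set.Iic t) ?_ _
    exact (hω i).1 (Finset.mem_range.1 hi)
  · intro i hi
    refine Set.indicator_of_notMem (s := Set.Iic t) ?_ _
    exact fun hc => hi (Finset.mem_range.2 ((hω i).2 hc))

end RiskModel
/-! ### The uniform asymptotics -/

section VectorSums

variable {d : ℕ} {Ω : Type*} [MeasurableSpace Ω] {P : Measure Ω} {A : Set (Fin d → ℝ)}
  {X : ℕ → Ω → Fin d → ℝ}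

lemma IsRareSet.measure_sum_smul_mem_le (hA : IsRareSet A) {n : ℕ} {w : ℕ → ℝ}
    (hw : ∀ i < n, 0 < w i) {x : ℝ} (hx : 0 < x) :
    P {ω | ∑ i ∈ Finset.range n, w i • X i ω ∈ x • A} ≤
      P {ω | x < ∑ i ∈ Finset.range n, w i * scaleSup A (X i ω)} :=
  measure_mono fun ω hω =>
    ((hA.lt_scaleSup_iff hx _).2 hω).trans_le (hA.scaleSup_sum_smul_le n hw fun i => X i ω)

lemma IsRareSet.le_measure_sum_smul_mem (hA : IsRareSet A) (hX : ∀ i, ∀ᵐ ω ∂P, 0 ≤ X i ω) {n : ℕ}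
    {w : ℕ → ℝ} (hw : ∀ i < n, 0 < w i) {x : ℝ} (hx : 0 < x) :
    P (⋃ i ∈ Finset.range n, {ω | x < w i * scaleSup A (X i ω)}) ≤
      P {ω | ∑ i ∈ Finset.range n, w i • X i ω ∈ x • A} := by
  refine measure_mono_ae ?_
  filter_upwards [ae_all_iff.2 hX] with ω hω h
  obtain ⟨i, hi, h⟩ := Set.mem_iUnion₂.1 h
  exact (hA.lt_scaleSup_iff hx _).1 (lt_of_lt_of_le h
    (hA.le_scaleSup_sum_smul hw hω (Finset.mem_range.1 hi)))

end VectorSums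

namespace RiskModel

variable {d : ℕ} {Ω : Type*} [m₀ : MeasurableSpace Ω] {P : Measure Ω} {R : RiskModel d P}

lemma BoundedReturnsOn.exists_weight_bounds {T : ℝ≥0} (h : R.BoundedReturnsOn T) :
    ∃ a b : ℝ, 0 < a ∧ a ≤ b ∧ ∀ᵐ ω ∂P, ∀ i, arrivalTime R.interarrival (i + 1) ω ≤ T →
      a ≤ R.weight i ω ∧ R.weight i ω ≤ b := by
  obtain ⟨C₁, C₂, h0, h12, h1, h2⟩ := h
  refine ⟨Real.exp (-C₂), Real.exp C₁, Real.exp_pos _, Real.exp_le_exp.2 (by linarith), ?_⟩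
  filter_upwards [h1, h2] with ω hω1 hω2 i hi
  exact ⟨Real.exp_le_exp.2 (neg_le_neg (hω2 _ hi)),
    Real.exp_le_exp.2 (by linarith [hω1 _ hi])⟩

lemma lintegral_conditionalMean_lt_top (V : Measure ℝ) [IsProbabilityMeasure V] (x : ℝ) (t : ℝ≥0) :
    ∫⁻ ω, R.conditionalMean V x t ω ∂P < ∞ := by
  refine lt_of_le_of_lt (lintegral_mono fun ω => ?_) (R.renewalFunction_lt_top t)
  calc R.conditionalMean V x t ω ≤ ∑ _i ∈ Finset.range (R.number t ω), 1 :=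
        Finset.sum_le_sum fun i _ => prob_le_one
    _ = (R.number t ω : ℝ≥0∞) := by simp
    _ ≤ (count R.interarrival t ω : ℝ≥0∞) := by
        have h : ((R.number t ω : ℕ∞) : ℝ≥0∞) ≤ (count R.interarrival t ω : ℝ≥0∞) :=
          ENat.toENNReal_le.2 (ENat.natCast_toNat_le_self _)
        simpa using h

/-- The first claim alone bounds the expected number of large claims from below. -/
lemma mul_measure_first_le_lintegral (V : Measure ℝ) {a x : ℝ} (ha : 0 < a) (hx : 0 ≤ x)
    {t T : ℝ≥0} (ht : t ≤ T) {b : ℝ} (hw : ∀ᵐ ω ∂P, ∀ i,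
      arrivalTime R.interarrival (i + 1) ω ≤ T → a ≤ R.weight i ω ∧ R.weight i ω ≤ b) :
    V (Set.Ioi (x / a)) * P {ω | R.interarrival 0 ω ≤ t} ≤
      ∫⁻ ω, R.conditionalMean V x t ω ∂P := by
  have hm : MeasurableSet {ω | R.interarrival 0 ω ≤ t} :=
    R.measurable_interarrival 0 measurableSet_Iic
  rw [← lintegral_indicator_const hm]
  refine lintegral_mono_ae ?_
  filter_upwards [hw, R.ae_lt_number_iff t] with ω hω hN
  by_cases h : ω ∈ {ω | R.interarrival 0 ω ≤ t}
  · rw [Set.indicator_of_mem h]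
    have h1 : arrivalTime R.interarrival (0 + 1) ω ≤ t := by simpa [arrivalTime] using h
    refine le_trans (measure_mono (Set.Ioi_subset_Ioi ?_)) (Finset.single_le_sum
      (f := fun i => V (Set.Ioi (x / R.weight i ω))) (fun _ _ => zero_le)
      (Finset.mem_range.2 ((hN 0).2 h1)))
    exact div_le_div_of_nonneg_left hx ha (hω 0 (h1.trans ht)).1
  · rw [Set.indicator_of_notMem h]
    exact zero_le

/-- The two-sided estimate: given arrivals and returns, claim numbers up to `m` are covered by the
asymptotics with deterministic weights, while larger claim numbers contribute negligibly because of
the exponential moments of the counting process. -/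
lemma eventually_measure_discountedClaims [IsProbabilityMeasure P] {A : Set (Fin d → ℝ)}
    (hA : IsRareSet A) {F : Measure (Fin d → ℝ)} (hlaw : ∀ i, P.map (R.claim i) = F)
    (hF : MemDLOn A F) (htai : PairwiseTAIOn P A R.claim) (hindep : R.MutuallyIndependent)
    {T : ℝ≥0} (hξ : R.BoundedReturnsOn T) {ε : ℝ≥0} (hε : 0 < ε) :
    ∀ᶠ x in atTop, ∀ t ≤ T,
      P {ω | R.discountedClaims t ω ∈ x • A} ≤
        (1 + ε) * ∫⁻ ω, R.conditionalMean (lawOn F A) x t ω ∂P ∧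
      ∫⁻ ω, R.conditionalMean (lawOn F A) x t ω ∂P ≤
        P {ω | R.discountedClaims t ω ∈ x • A} +
          ε * ∫⁻ ω, R.conditionalMean (lawOn F A) x t ω ∂P := by
  have hFp : IsProbabilityMeasure F := by
    rw [← hlaw 0]
    exact Measure.isProbabilityMeasure_map (R.measurable_claim 0).aemeasurable
  set V := lawOn F A with hV
  have hVp : IsProbabilityMeasure V :=
    Measure.isProbabilityMeasure_map hA.measurable_scaleSup.aemeasurable
  set Y : ℕ → Ω → ℝ := fun i ω => scaleSup A (R.claim i ω)
  have hYm : ∀ i, Measurable (Y i) := fun i => hA.measurable_scaleSup.comp (R.measurable_claim i)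
  have hYV : ∀ i, P.map (Y i) = V := fun i => by
    rw [hV, lawOn, ← hlaw i, Measure.map_map hA.measurable_scaleSup (R.measurable_claim i)]
    rfl
  obtain ⟨p, hp⟩ := hF.1.exists_half
  obtain ⟨a, b, ha, hab, hw⟩ := hξ.exists_weight_bounds
  have hb : 0 < b := ha.trans_le hab
  -- dominated variation compares the tails at the two extreme weights
  obtain ⟨k, hk⟩ := exists_nat_ge (b / a)
  have hk1 : 1 ≤ k := by
    have : (1 : ℝ) ≤ k := ((one_le_div ha).2 hab).trans hk
    exact_mod_cast this
  set C : ℝ≥0 := (2 * k) ^ p with hC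
  have hC0 : 0 < C := by
    have : (0 : ℝ≥0) < k := by exact_mod_cast hk1
    positivity
  have hVC : ∀ x : ℝ, 0 ≤ x → V (Set.Ioi (x / b)) ≤ C * V (Set.Ioi (x / a)) := by
    intro x hx
    refine (measure_mono (Set.Ioi_subset_Ioi ?_)).trans
      ((tail_div_le hp hk1 (div_nonneg hx ha.le)).trans_eq (by rw [hC]; push_cast; rfl))
    rw [div_div]
    exact div_le_div_of_nonneg_left hx hb ((div_le_iff₀' ha).1 hk)
  set η : ℝ≥0 := ε / 2 / (2 ^ p * C) with hη
  have hη0 : 0 < η := by positivity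
  have hηC : (2 : ℝ≥0∞) ^ p * (η * C) = (ε / 2 : ℝ≥0) := by
    have : (2 : ℝ≥0) ^ p * (η * C) = ε / 2 := by
      rw [hη]
      field_simp
    exact_mod_cast this
  obtain ⟨m, hm⟩ := exists_lintegral_count_pow_le R.measurable_interarrival R.iIndepFun_interarrival
    R.identDistrib_interarrival (R.renewalFunction_lt_top 0) T (p + 1)
    (ε := (η : ℝ≥0∞)) (by exact_mod_cast hη0)
  have hev : ∀ᶠ x in atTop, ∀ n ∈ Finset.range (m + 1), ∀ w : ℕ → ℝ,
      (∀ i < n, a ≤ w i ∧ w i ≤ b) →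
      P {ω | x < ∑ i ∈ Finset.range n, w i * Y i ω} ≤
        (1 + (ε / 2 : ℝ≥0)) * ∑ i ∈ Finset.range n, V (Set.Ioi (x / w i)) ∧
      ∑ i ∈ Finset.range n, V (Set.Ioi (x / w i)) ≤
        P (⋃ i ∈ Finset.range n, {ω | x < w i * Y i ω}) +
          (ε / 2 : ℝ≥0) * ∑ i ∈ Finset.range n, V (Set.Ioi (x / w i)) := by
    rw [Filter.eventually_all_finset]
    intro n _
    have hε2 : 0 < ε / 2 := by positivity
    filter_upwards [eventually_measure_lt_sum_le (b := b) hYm hYV hF.2 hp htai n ha hε2,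
      eventually_sum_tail_le hYm hYV htai n hb hε2] with x h1 h2 w hwn
    exact ⟨h1 w hwn, h2 w fun i hi => ⟨ha.trans_le (hwn i hi).1, (hwn i hi).2⟩⟩
  filter_upwards [hev, eventually_gt_atTop 0] with x hx hx0 t ht
  set H := ∫⁻ ω, R.conditionalMean V x t ω ∂P with hH
  -- the contribution of more than `m` claims
  let r : Ω → ℝ≥0∞ := fun ω => V (Set.Ioi (x / b)) * 2 ^ p *
    (if m < (count R.interarrival t ω).toNat then
      ((count R.interarrival t ω).toNat : ℝ≥0∞) ^ (p + 1) else 0)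
  have hrm : Measurable r :=
    ((Measurable.of_discrete (f := fun n : ℕ => if m < n then (n : ℝ≥0∞) ^ (p + 1) else 0)).comp
      (R.measurable_number t)).const_mul _
  have hr : ∫⁻ ω, r ω ∂P ≤ (ε / 2 : ℝ≥0) * H := by
    rw [lintegral_const_mul' _ _ (ENNReal.mul_ne_top (measure_ne_top _ _) (by finiteness))]
    calc _ ≤ C * V (Set.Ioi (x / a)) * 2 ^ p * (η * P {ω | R.interarrival 0 ω ≤ t}) := by
          gcongr
          · exact hVC x hx0.le
          · exact hm t ht
      _ = 2 ^ p * (η * C) * (V (Set.Ioi (x / a)) * P {ω | R.interarrival 0 ω ≤ t}) := by ring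
      _ ≤ (ε / 2 : ℝ≥0) * H := by
          rw [hηC]
          gcongr
          exact mul_measure_first_le_lintegral V ha hx0.le ht hw
  let g : Ω → ℝ≥0∞ := fun ω =>
    P {ω' | ∑ i ∈ Finset.range (R.number t ω), R.weight i ω • R.claim i ω' ∈ x • A}
  have hG : P {ω | R.discountedClaims t ω ∈ x • A} = ∫⁻ ω, g ω ∂P :=
    measure_discountedClaims hindep hA hx0 t
  have hpt : ∀ᵐ ω ∂P,
      g ω ≤ (1 + (ε / 2 : ℝ≥0)) * R.conditionalMean V x t ω + r ω ∧
      R.conditionalMean V x t ω ≤ g ω + r ω + (ε / 2 : ℝ≥0) * R.conditionalMean V x t ω := by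
    filter_upwards [hw] with ω hω
    have hwn : ∀ i < R.number t ω, a ≤ R.weight i ω ∧ R.weight i ω ≤ b := fun i hi =>
      hω i ((arrivalTime_le_of_lt_toNat_count hi).trans ht)
    have hg1 : g ω ≤ P {ω' | x < ∑ i ∈ Finset.range (R.number t ω), R.weight i ω * Y i ω'} :=
      hA.measure_sum_smul_mem_le (fun i _ => R.weight_pos i ω) hx0
    have hg2 : P (⋃ i ∈ Finset.range (R.number t ω), {ω' | x < R.weight i ω * Y i ω'}) ≤ g ω :=
      hA.le_measure_sum_smul_mem R.claim_nonneg (fun i _ => R.weight_pos i ω) hx0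
    rcases Nat.lt_or_ge m (R.number t ω) with hmn | hmn
    · have hrv : r ω = R.number t ω * (2 * R.number t ω) ^ p * V (Set.Ioi (x / b)) := by
        have hmn' : m < (count R.interarrival t ω).toNat := hmn
        simp only [r, if_pos hmn', number]
        ring
      refine ⟨le_add_left ?_, le_add_right (le_add_left ?_)⟩
      · rw [hrv]
        exact hg1.trans (measure_lt_sum_le_pow hYm hYV hp hb hx0.le
          fun i hi => ⟨R.weight_pos i ω, (hwn i hi).2⟩)
      · rw [hrv, conditionalMean]
        refine (Finset.sum_le_sum (g := fun _ => V (Set.Ioi (x / b))) fun i hi =>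
          measure_mono (Set.Ioi_subset_Ioi ?_)).trans ?_
        · exact div_le_div_of_nonneg_left hx0.le (R.weight_pos i ω)
            (hwn i (Finset.mem_range.1 hi)).2
        · rw [Finset.sum_const, Finset.card_range, nsmul_eq_mul]
          gcongr
          refine le_mul_of_one_le_right' (one_le_pow_of_one_le' ?_ p)
          have : 1 ≤ 2 * R.number t ω := by omega
          exact_mod_cast this
    · obtain ⟨h1, h2⟩ := hx (R.number t ω) (Finset.mem_range.2 (by omega))
        (fun i => R.weight i ω) hwn
      exact ⟨le_add_right (hg1.trans h1), h2.trans (add_le_add (le_add_right hg2) le_rfl)⟩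
  have hhm : Measurable fun ω => (ε / 2 : ℝ≥0) * R.conditionalMean V x t ω :=
    (R.measurable_conditionalMean V x t).const_mul _
  have hhH : ∫⁻ ω, (ε / 2 : ℝ≥0) * R.conditionalMean V x t ω ∂P = (ε / 2 : ℝ≥0) * H :=
    lintegral_const_mul' _ _ ENNReal.coe_ne_top
  have hsplit : ((ε / 2 : ℝ≥0) : ℝ≥0∞) + (ε / 2 : ℝ≥0) = ε := by
    rw [← ENNReal.coe_add, add_halves]
  rw [hG]
  constructor
  · calc ∫⁻ ω, g ω ∂P
        ≤ ∫⁻ ω, ((1 + (ε / 2 : ℝ≥0)) * R.conditionalMean V x t ω + r ω) ∂P :=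
          lintegral_mono_ae (hpt.mono fun ω h => h.1)
      _ = (1 + (ε / 2 : ℝ≥0)) * H + ∫⁻ ω, r ω ∂P := by
          rw [lintegral_add_right _ hrm, lintegral_const_mul' _ _ (by finiteness)]
      _ ≤ (1 + (ε / 2 : ℝ≥0)) * H + (ε / 2 : ℝ≥0) * H := by gcongr
      _ = (1 + ε) * H := by rw [← add_mul, add_assoc, hsplit]
  · calc H ≤ ∫⁻ ω, (g ω + r ω + (ε / 2 : ℝ≥0) * R.conditionalMean V x t ω) ∂P :=
          lintegral_mono_ae (hpt.mono fun ω h => h.2)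
      _ = ∫⁻ ω, g ω ∂P + ∫⁻ ω, r ω ∂P + (ε / 2 : ℝ≥0) * H := by
          rw [lintegral_add_right _ hhm, lintegral_add_right _ hrm, hhH]
      _ ≤ ∫⁻ ω, g ω ∂P + (ε / 2 : ℝ≥0) * H + (ε / 2 : ℝ≥0) * H := by gcongr
      _ = ∫⁻ ω, g ω ∂P + ε * H := by rw [add_assoc, ← add_mul, hsplit]

end RiskModel

lemma abs_toReal_div_sub_one_le {G H : ℝ≥0∞} (hH0 : H ≠ 0) (hH : H ≠ ∞) {ε : ℝ≥0}
    (h1 : G ≤ (1 + ε) * H) (h2 : H ≤ G + ε * H) : |G.toReal / H.toReal - 1| ≤ ε := by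
  have hG : G ≠ ∞ := ne_top_of_le_ne_top (by finiteness) h1
  have hpos : 0 < H.toReal := ENNReal.toReal_pos hH0 hH
  have h1' := ENNReal.toReal_mono (by finiteness) h1
  have h2' := ENNReal.toReal_mono (by finiteness) h2
  rw [ENNReal.toReal_mul, ENNReal.toReal_add (by finiteness) (by finiteness)] at h1'
  rw [ENNReal.toReal_add hG (by finiteness), ENNReal.toReal_mul] at h2'
  simp only [ENNReal.toReal_one, ENNReal.coe_toReal] at h1' h2'
  rw [abs_le, div_sub_one hpos.ne', le_div_iff₀ hpos, div_le_iff₀ hpos]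
  constructor <;> linarith

end RuinModel

theorem mainTheorem1 {Ω : Type*} [MeasurableSpace Ω] (P : Measure Ω) [IsProbabilityMeasure P]
    (d : ℕ) (A : Set (Fin d → ℝ)) (hA : RuinModel.IsRareSet A)
    (R : RuinModel.RiskModel d P) (F : Measure (Fin d → ℝ))
    (hlaw : ∀ i, P.map (R.claim i) = F)
    (hF : RuinModel.MemDLOn A F)
    (htai : RuinModel.PairwiseTAIOn P A R.claim)
    (hindep : R.MutuallyIndependent)
    (T : ℝ≥0) (hT : 0 < T) (hξ : R.BoundedReturnsOn T) :
    RuinModel.UniformAsympEquivOn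
      (fun (x : ℝ) (t : ℝ≥0) => P.real {ω | R.discountedClaims t ω ∈ x • A})
      (fun (x : ℝ) (t : ℝ≥0) => R.singleClaimIntegral A x t)
      (R.horizon T) := by
  have hFp : IsProbabilityMeasure F := by
    rw [← hlaw 0]
    exact Measure.isProbabilityMeasure_map (R.measurable_claim 0).aemeasurable
  have hVp : IsProbabilityMeasure (RuinModel.lawOn F A) :=
    Measure.isProbabilityMeasure_map hA.measurable_scaleSup.aemeasurable
  obtain ⟨a, b, ha, -, hw⟩ := hξ.exists_weight_bounds
  rw [RuinModel.UniformAsympEquivOn, Metric.tendstoUniformlyOn_iff]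
  intro ε hε
  lift ε to ℝ≥0 using hε.le
  have hε' : 0 < ε := hε
  filter_upwards [RuinModel.RiskModel.eventually_measure_discountedClaims hA hlaw hF htai hindep hξ
    (ε := ε / 2) (by positivity), eventually_gt_atTop 0] with x hx hx0 t ht
  obtain ⟨⟨-, htT⟩, htpos⟩ := ht
  obtain ⟨h1, h2⟩ := hx t htT
  have hHpos : 0 < ∫⁻ ω, R.conditionalMean (RuinModel.lawOn F A) x t ω ∂P :=
    (ENNReal.mul_pos (hF.1.1 (x / a)).ne'
      (RuinModel.measure_first_pos R.measurable_interarrival htpos).ne').trans_le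
      (RuinModel.RiskModel.mul_measure_first_le_lintegral _ ha hx0.le htT hw)
  have hint : R.singleClaimIntegral A x t =
      (∫⁻ ω, R.conditionalMean (RuinModel.lawOn F A) x t ω ∂P).toReal := by
    rw [RuinModel.RiskModel.singleClaimIntegral,
      RuinModel.RiskModel.lintegral_singleClaim hindep hA hx0 t, hlaw 0]
  rw [dist_comm, Real.dist_eq, hint, measureReal_def]
  refine (RuinModel.abs_toReal_div_sub_one_le hHpos.ne'
    (RuinModel.RiskModel.lintegral_conditionalMean_lt_top _ x t).ne h1 h2).trans_lt ?_
  rw [NNReal.coe_div]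
  exact half_lt_self hε
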